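/- Let $(X,\omega_X)$ be a compact connected Kähler manifold of dimension $n$ and let $(E,\Phi)$ be a Higgs bundle of rank $r$ on $X$: $E$ is a holomorphic vector bundle and $\Phi$ is a holomorphic $(1,0)$-form with values in $\operatorname{End}E$ such that $\Phi\wedge\Phi=0$. Suppose that $E=L_1\oplus\cdots\oplus L_r$ with holomorphic line bundles $L_1,\dots,L_r$, and for $i\neq j$ let $\Phi_{i,j}$ be the component of $\Phi$ with values in $L_j^{-1}L_i$. Let $m_j=\deg L_j=\int_X c_1(L_j)\wedge\omega_X^{n-1}/(n-1)!$ be the degree of $L_j$ with respect to $\omega_X$, where $c_1(L_j)$ is represented by $\frac{\sqrt{-1}}{2\pi}$ times the curvature of a Hermitian metric, and suppose that $\deg E=m_1+\cdots+m_r=0$. Put $\gamma=(m_1,\dots,m_r)\in\mathbb R^r$, and let $e_1,\dots,e_r$ be the standard basis of $\mathbb R^r$. The Higgs bundle $(E,\Phi)$ is called semistable (respectively stable) if $\deg(S)/\operatorname{rk}(S)\le\deg(E)/r$ (respectively $<$) for every coherent subsheaf $S$ of $E$ that is preserved by $\Phi$ and satisfies $0<\operatorname{rk}(S)<r$, where $\deg(S)$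 is the degree of the determinant line bundle of $S$. (i) If $(E,\Phi)$ is semistable, then $$-\gamma\in\sum_{i\ne j,\ \Phi_{i,j}\neq 0}\mathbb R_{\ge 0}\,(e_i-e_j),$$ and if moreover $m_1,\dots,m_r$ are rational numbers, then $$-\gamma\in\sum_{i\ne j,\ \Phi_{i,j}\neq 0}\mathbb Q_{\ge 0}\,(e_i-e_j).$$ (ii) If $(E,\Phi)$ is stable, then $$-\gamma\in\sum_{i\ne j,\ \Phi_{i,j}\neq 0}\mathbb R_{>0}\,(e_i-e_j),$$ and if moreover $m_1,\dots,m_r$ are rational numbers, then $$-\gamma\in\sum_{i\ne j,\ \Phi_{i,j}\neq 0}\mathbb Q_{>0}\,(e_i-e_j).$$ (In (ii) all coefficients are strictly positive; a sum over no pairs is $\{0\}$.) -/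

import Mathlib

open Bundle Set Filter Topology MeasureTheory TopologicalSpace
open scoped Manifold ContDiff

noncomputable section

namespace HiggsCone

universe u v w

/-- The local model `ℂⁿ` of an `n`-dimensional complex manifold. -/
abbrev Cn (n : ℕ) : Type := Fin n → ℂ

/-! ### Holomorphic functions, vector fields and vector bundles -/

section Bundles

/-- A holomorphic vector bundle over the complex manifold `X`, with model fibre `F`:
a topological vector bundle whose transition functions are holomorphic. -/
structure HolBundle (n : ℕ) (X : Type u) [TopologicalSpace X] [ChartedSpace (Cn n) X]
    (F : Type w) [NormedAddCommGroup F] [NormedSpace ℂ F] where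
  Fib : X → Type v
  [topTotal : TopologicalSpace (TotalSpace F Fib)]
  [topFib : ∀ x, TopologicalSpace (Fib x)]
  [addFib : ∀ x, AddCommGroup (Fib x)]
  [modFib : ∀ x, Module ℂ (Fib x)]
  [fiberBundle : FiberBundle F Fib]
  [vectorBundle : VectorBundle ℂ F Fib]
  [holomorphic : ContMDiffVectorBundle ω F Fib 𝓘(ℂ, Cn n)]

attribute [instance] HolBundle.topTotal HolBundle.topFib HolBundle.addFib HolBundle.modFib
  HolBundle.fiberBundle HolBundle.vectorBundle HolBundle.holomorphic

variable {n : ℕ} {X : Type u} [TopologicalSpace X] [ChartedSpace (Cn n) X]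

variable (n) in
/-- `f` is a holomorphic function on `U`. -/
def IsHolFun (f : X → ℂ) (U : Set X) : Prop :=
  ContMDiffOn 𝓘(ℂ, Cn n) 𝓘(ℂ) ω f U

/-- `ξ` is a holomorphic vector field on `U` (a holomorphic section of the tangent bundle). -/
def IsHolField [IsManifold 𝓘(ℂ, Cn n) ω X] (ξ : ∀ x : X, TangentSpace 𝓘(ℂ, Cn n) x)
    (U : Set X) : Prop :=
  ContMDiffOn 𝓘(ℂ, Cn n) (𝓘(ℂ, Cn n).prod 𝓘(ℂ, Cn n)) ω
    (fun x => (TotalSpace.mk' (Cn n) x (ξ x) : TangentBundle 𝓘(ℂ, Cn n) X)) U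

variable {F : Type w} [NormedAddCommGroup F] [NormedSpace ℂ F]

/-- `s` is a holomorphic section of `E` on `U`. -/
def HolBundle.IsHolSection (E : HolBundle.{u, v, w} n X F) (s : ∀ x, E.Fib x) (U : Set X) : Prop :=
  ContMDiffOn 𝓘(ℂ, Cn n) (𝓘(ℂ, Cn n).prod 𝓘(ℂ, F)) ω (fun x => TotalSpace.mk' F x (s x)) U

end Bundles

/-! ### Kähler forms -/

section Kaehler

variable {n : ℕ} {X : Type u} [TopologicalSpace X] [ChartedSpace (Cn n) X]

/-- The expression of a real 2-form in the preferred chart at `c`, i.e. its pullback by the inverse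
of that chart. The tangent space `T_x X` is, as in Mathlib, modelled on `ℂⁿ` itself. -/
def formInChart (α : ∀ _ : X, (Cn n) [⋀^Fin 2]→L[ℝ] ℝ) (c : X) (z : Cn n) :
    (Cn n) [⋀^Fin 2]→L[ℝ] ℝ :=
  let T : Cn n →L[ℂ] Cn n := mfderiv 𝓘(ℂ, Cn n) 𝓘(ℂ, Cn n) (chartAt (Cn n) c).symm z
  (α ((chartAt (Cn n) c).symm z)).compContinuousLinearMap (T.restrictScalars ℝ)

variable (n X) in
/-- A Kähler form: a smooth closed real 2-form which is of type (1,1) (invariant under the complex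
structure) and positive. -/
structure KaehlerForm where
  toFun : ∀ _ : X, (Cn n) [⋀^Fin 2]→L[ℝ] ℝ
  smooth : ∀ c : X, ContDiffOn ℝ ∞ (formInChart toFun c) (chartAt (Cn n) c).target
  closed : ∀ c : X, ∀ z ∈ (chartAt (Cn n) c).target, extDeriv (formInChart toFun c) z = 0
  type_one_one : ∀ (x : X) (a b : Cn n),
    toFun x ![Complex.I • a, Complex.I • b] = toFun x ![a, b]
  positive : ∀ (x : X) (a : Cn n), a ≠ 0 → 0 < toFun x ![a, Complex.I • a]

/-- The coefficient matrix `(a_{jk})` of a real (1,1)-form `i ∑ a_{jk} dz_j ∧ dz̄_k` on `ℂⁿ`. -/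
def coeffMatrix (α : (Cn n) [⋀^Fin 2]→L[ℝ] ℝ) : Matrix (Fin n) (Fin n) ℂ :=
  Matrix.of fun j k =>
    ((α ![Pi.single j 1, Pi.single k Complex.I] : ℝ) -
      Complex.I * (α ![Pi.single j 1, Pi.single k 1] : ℝ)) / 2

/-- The second Wirtinger derivative `∂²u / ∂z_j ∂z̄_k` at `z` of a real function `u` on `ℂⁿ`. -/
def wirtinger (f : Cn n → ℝ) (z : Cn n) (j k : Fin n) : ℂ :=
  let D : Cn n → Cn n → ℝ := fun a b => fderiv ℝ (fun y => fderiv ℝ f y b) z a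
  ((D (Pi.single j 1) (Pi.single k 1) + D (Pi.single j Complex.I) (Pi.single k Complex.I) : ℝ) +
    Complex.I * (D (Pi.single j 1) (Pi.single k Complex.I) -
      D (Pi.single j Complex.I) (Pi.single k 1) : ℝ)) / 4

end Kaehler

/-! ### Degrees of line bundles -/

section Degree

variable {n : ℕ} {X : Type u} [TopologicalSpace X] [ChartedSpace (Cn n) X]

/-- The local holomorphic frame of a line bundle given by the preferred local trivialization
around `x`. -/
def HolBundle.frame (L : HolBundle.{u, v, 0} n X ℂ) (x y : X) : L.Fib y :=
  (trivializationAt ℂ L.Fib x).symm y 1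

/-- A smooth Hermitian metric on a holomorphic line bundle, given by its squared norm. -/
structure HermMetric (L : HolBundle.{u, v, 0} n X ℂ) where
  normSq : ∀ x, L.Fib x → ℝ
  normSq_smul : ∀ (x : X) (a : ℂ) (e : L.Fib x), normSq x (a • e) = ‖a‖ ^ 2 * normSq x e
  normSq_pos : ∀ (x : X) (e : L.Fib x), e ≠ 0 → 0 < normSq x e
  smooth : ∀ x c : X,
    ContDiffOn ℝ ∞ (fun z => normSq ((chartAt (Cn n) c).symm z) (L.frame x _))
      ((chartAt (Cn n) c).target ∩
        (chartAt (Cn n) c).symm ⁻¹' (trivializationAt ℂ L.Fib x).baseSet)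

/-- In the chart at `c`, the coefficient matrix at `z` of the first Chern form
`(i/2π) F_h = -(i/2π) ∂∂̄ log h(e)`, where `F_h` is the curvature of the Chern connection of `h`
and `e` is the preferred holomorphic frame around the point with coordinate `z` (any other
holomorphic frame gives the same form). -/
def HermMetric.chernMatrix {L : HolBundle.{u, v, 0} n X ℂ} (h : HermMetric L) (c : X) (z : Cn n) :
    Matrix (Fin n) (Fin n) ℂ :=
  Matrix.of fun j k =>
    -(1 / (2 * (Real.pi : ℂ))) *
      wirtinger (fun y => Real.log (h.normSq ((chartAt (Cn n) c).symm y)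
        (L.frame ((chartAt (Cn n) c).symm z) _))) z j k

/-- In the chart at `c`, the density with respect to Lebesgue measure on `ℂⁿ` of the top-degree form
`(i/2π) F_h ∧ κ^{n-1} / (n-1)!`. For (1,1)-forms `α = i ∑ a_{jk} dz_j ∧ dz̄_k` and
`κ = i ∑ g_{jk} dz_j ∧ dz̄_k` one has `κⁿ / n! = 2ⁿ det(g) dλ`, and, differentiating at `κ` in the
direction `α`, `α ∧ κ^{n-1} / (n-1)! = 2ⁿ tr(adj(g) a) dλ`. -/
def degreeDensity (κ : KaehlerForm n X) {L : HolBundle.{u, v, 0} n X ℂ} (h : HermMetric L)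
    (c : X) (z : Cn n) : ℝ :=
  2 ^ n * ((coeffMatrix (formInChart κ.toFun c z)).adjugate * h.chernMatrix c z).trace.re

variable [CompactSpace X] [T2Space X]

variable (n X) in
theorem exists_chartPartition :
    ∃ ρ : PartitionOfUnity X X, ρ.IsSubordinate fun c : X => (chartAt (Cn n) c).source :=
  PartitionOfUnity.exists_isSubordinate isClosed_univ _
    (fun c => (chartAt (Cn n) c).open_source)
    (fun x _ => mem_iUnion.2 ⟨x, mem_chart_source (Cn n) x⟩)

variable (n X) in
/-- A partition of unity subordinate to the preferred charts. -/
def chartPartition : PartitionOfUnity X X := (exists_chartPartition n X).choose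

/-- The integral over `X` of the top-degree form whose density in the chart at `c` is `η c`
(computed with a partition of unity; the result does not depend on it). -/
def integralForm (η : X → Cn n → ℝ) : ℝ :=
  ∑ᶠ c : X, ∫ z in (chartAt (Cn n) c).target,
    chartPartition n X c ((chartAt (Cn n) c).symm z) * η c z

/-- `d` is the degree `∫_X (i/2π) F_h ∧ κ^{n-1} / (n-1)!` of the line bundle `L` with respect to the
Kähler form `κ`, computed with some Hermitian metric `h` on `L` (every metric gives the same
number). -/
def HasDegree (κ : KaehlerForm n X) (L : HolBundle.{u, v, 0} n X ℂ) (d : ℝ) : Prop :=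
  ∃ h : HermMetric L, d = integralForm (degreeDensity κ h)

end Degree

/-! ### Coherent subsheaves -/

section Sheaves

variable {n : ℕ} {X : Type u} [TopologicalSpace X] [ChartedSpace (Cn n) X]
variable {F : Type w} [NormedAddCommGroup F] [NormedSpace ℂ F]

/-- A sheaf of `𝓞_X`-submodules of the sheaf `𝓞(E)` of holomorphic sections of `E`.
A section over `U` is represented by a function defined on all of `X`, of which only the restriction
to `U` matters. -/
structure HolSubsheaf (E : HolBundle.{u, v, w} n X F) where
  /-- `mem U s`: the restriction of `s` to `U` is a section of the subsheaf over `U`. -/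
  mem : Opens X → (∀ x, E.Fib x) → Prop
  holomorphic : ∀ U s, mem U s → E.IsHolSection s U
  congr : ∀ (U : Opens X) s t, (∀ x ∈ U, s x = t x) → mem U s → mem U t
  zero : ∀ U, mem U fun _ => 0
  add : ∀ U s t, mem U s → mem U t → mem U fun x => s x + t x
  smul : ∀ (U : Opens X) (f : X → ℂ) s, IsHolFun n f (U : Set X) → mem U s → mem U fun x => f x • s x
  restrict : ∀ (U V : Opens X) s, V ≤ U → mem U s → mem V s
  glue : ∀ (U : Opens X) s, (∀ x ∈ U, ∃ V : Opens X, x ∈ V ∧ V ≤ U ∧ mem V s) → mem U s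

/-- The sheaf `𝓞(E)` itself. -/
def HolSubsheaf.whole (E : HolBundle.{u, v, w} n X F) : HolSubsheaf E where
  mem U s := E.IsHolSection s U
  holomorphic _ _ h := h
  congr U s t h hs := hs.congr fun x hx => by rw [h x hx]
  zero U := (contMDiff_zeroSection ℂ E.Fib).contMDiffOn
  add U s t hs ht := ContMDiffOn.add_section hs ht
  smul U f s hf hs := ContMDiffOn.smul_section hf hs
  restrict U V s h hs := hs.mono h
  glue U s h := fun x hx => by
    obtain ⟨V, hxV, _, hV⟩ := h x hx
    exact (hV.contMDiffAt (V.isOpen.mem_nhds hxV)).contMDiffWithinAt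

variable {E : HolBundle.{u, v, w} n X F}

/-- Coherence: the subsheaf is locally generated by finitely many sections. (For subsheaves of a
locally free sheaf of finite rank this is coherence, by Oka's theorem.) -/
def HolSubsheaf.IsCoherent (S : HolSubsheaf E) : Prop :=
  ∀ x : X, ∃ U : Opens X, x ∈ U ∧ ∃ (k : ℕ) (σ : Fin k → ∀ y, E.Fib y), (∀ i, S.mem U (σ i)) ∧
    ∀ (V : Opens X) (t : ∀ y, E.Fib y), V ≤ U → S.mem V t → ∀ y ∈ V, ∃ W : Opens X, y ∈ W ∧ W ≤ V ∧
      ∃ f : Fin k → X → ℂ, (∀ i, IsHolFun n (f i) (W : Set X)) ∧ ∀ p ∈ W, t p = ∑ i, f i p • σ i p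

/-- `v₁, …, v_s` is a basis of the subsheaf over `U`, which is thus free of rank `s` there. -/
def HolSubsheaf.IsBasisOn (S : HolSubsheaf E) (U : Opens X) {s : ℕ}
    (b : Fin s → ∀ y, E.Fib y) : Prop :=
  (∀ i, S.mem U (b i)) ∧
  (∀ (V : Opens X) (t : ∀ y, E.Fib y), V ≤ U → S.mem V t →
    ∃ f : Fin s → X → ℂ, (∀ i, IsHolFun n (f i) (V : Set X)) ∧ ∀ p ∈ V, t p = ∑ i, f i p • b i p) ∧
  (∀ (V : Opens X) (f : Fin s → X → ℂ), V ≤ U → (∀ i, IsHolFun n (f i) (V : Set X)) →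
    (∀ p ∈ V, ∑ i, f i p • b i p = 0) → ∀ i, ∀ p ∈ V, f i p = 0)

variable (n) in
/-- `Z` is a closed analytic subset of `X` of codimension at least 2: it is locally the common zero
set of finitely many holomorphic functions, and through each of its points there is a complex
2-plane (in a chart) meeting `Z` in an isolated point. -/
def IsAnalyticCodimGeTwo (Z : Set X) : Prop :=
  IsClosed Z ∧
  (∀ x : X, ∃ U : Opens X, x ∈ U ∧ ∃ (k : ℕ) (f : Fin k → X → ℂ),
    (∀ i, IsHolFun n (f i) (U : Set X)) ∧ ∀ y ∈ U, y ∈ Z ↔ ∀ i, f i y = 0) ∧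
  (∀ x ∈ Z, ∃ A : (Fin 2 → ℂ) →ₗ[ℂ] Cn n, Function.Injective A ∧
    ∀ᶠ t in 𝓝[≠] (0 : Fin 2 → ℂ), (chartAt (Cn n) x).symm (chartAt (Cn n) x x + A t) ∉ Z)

/-- The subsheaf `S` has rank `s` and the holomorphic line bundle `M` is its determinant
`det S = (Λˢ S)^{**}`: outside an analytic subset `Z` of codimension at least 2, `S` is locally free
of rank `s`, and `M` is isomorphic to `Λˢ S`, by a map `j` which takes local frames of `M` to
`v₁ ∧ … ∧ v_s` for local bases `v` of `S`. -/
def HolSubsheaf.IsDeterminant (S : HolSubsheaf E) (s : ℕ) (M : HolBundle.{u, 0, 0} n X ℂ) : Prop :=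
  ∃ Z : Set X, IsAnalyticCodimGeTwo n Z ∧
  ∃ j : ∀ x, M.Fib x →ₗ[ℂ] ⋀[ℂ]^s (E.Fib x),
    ∀ x ∉ Z, ∃ U : Opens X, x ∈ U ∧ Disjoint (U : Set X) Z ∧
      ∃ (m : ∀ y, M.Fib y) (b : Fin s → ∀ y, E.Fib y),
        M.IsHolSection m U ∧ (∀ y ∈ U, m y ≠ 0) ∧ S.IsBasisOn U b ∧
        ∀ y ∈ U, j y (m y) = exteriorPower.ιMulti ℂ s (fun i => b i y)

/-- The coherent subsheaf `S` has rank `s` and degree `d` with respect to the Kähler form `κ`: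
`d` is the degree of its determinant line bundle. -/
def HolSubsheaf.HasRankDegree [CompactSpace X] [T2Space X] (κ : KaehlerForm n X)
    (S : HolSubsheaf E) (s : ℕ) (d : ℝ) : Prop :=
  ∃ M : HolBundle.{u, 0, 0} n X ℂ, S.IsDeterminant s M ∧ HasDegree κ M d

end Sheaves

/-! ### Higgs bundles -/

section Higgs

variable {n : ℕ} {X : Type u} [TopologicalSpace X] [ChartedSpace (Cn n) X]
variable [IsManifold 𝓘(ℂ, Cn n) ω X] {r : ℕ}

/-- A Higgs field on `E`: a holomorphic (1,0)-form `Φ` with values in `End E` such that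
`Φ ∧ Φ = 0`. -/
structure HiggsField (E : HolBundle.{u, v, 0} n X (Fin r → ℂ)) where
  toFun : ∀ x : X, TangentSpace 𝓘(ℂ, Cn n) x →ₗ[ℂ] (E.Fib x →ₗ[ℂ] E.Fib x)
  holomorphic : ∀ (U : Opens X) (ξ : ∀ x : X, TangentSpace 𝓘(ℂ, Cn n) x) (s : ∀ x, E.Fib x),
    IsHolField ξ (U : Set X) → E.IsHolSection s U → E.IsHolSection (fun x => toFun x (ξ x) (s x)) U
  integrable : ∀ (x : X) (a b : TangentSpace 𝓘(ℂ, Cn n) x),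
    toFun x a ∘ₗ toFun x b = toFun x b ∘ₗ toFun x a

/-- The subsheaf `S` is preserved by the Higgs field: `Φ(S) ⊆ S ⊗ Ω¹`. -/
def HiggsField.Preserves {E : HolBundle.{u, v, 0} n X (Fin r → ℂ)} (Φ : HiggsField E)
    (S : HolSubsheaf E) : Prop :=
  ∀ (U : Opens X) (ξ : ∀ x : X, TangentSpace 𝓘(ℂ, Cn n) x) (s : ∀ x, E.Fib x),
    IsHolField ξ (U : Set X) → S.mem U s → S.mem U fun x => Φ.toFun x (ξ x) (s x)

variable [CompactSpace X] [T2Space X]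

/-- Semistability of `(E, Φ)` with respect to `κ`: every coherent subsheaf `S` of `𝓞(E)` preserved
by `Φ`, of rank `0 < s < r`, has slope at most that of `E`. -/
def IsSemistable (κ : KaehlerForm n X) (E : HolBundle.{u, v, 0} n X (Fin r → ℂ))
    (Φ : HiggsField E) : Prop :=
  ∀ S : HolSubsheaf E, S.IsCoherent → Φ.Preserves S → ∀ (s : ℕ) (d dE : ℝ), 0 < s → s < r →
    S.HasRankDegree κ s d → (HolSubsheaf.whole E).HasRankDegree κ r dE → d / s ≤ dE / r

/-- Stability of `(E, Φ)` with respect to `κ`: every coherent subsheaf `S` of `𝓞(E)` preserved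
by `Φ`, of rank `0 < s < r`, has slope less than that of `E`. -/
def IsStable (κ : KaehlerForm n X) (E : HolBundle.{u, v, 0} n X (Fin r → ℂ))
    (Φ : HiggsField E) : Prop :=
  ∀ S : HolSubsheaf E, S.IsCoherent → Φ.Preserves S → ∀ (s : ℕ) (d dE : ℝ), 0 < s → s < r →
    S.HasRankDegree κ s d → (HolSubsheaf.whole E).HasRankDegree κ r dE → d / s < dE / r

end Higgs

/-! ### Decompositions into line bundles -/

section Decomposition

variable {n : ℕ} {X : Type u} [TopologicalSpace X] [ChartedSpace (Cn n) X] {r : ℕ}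

/-- A holomorphic direct sum decomposition `E = L₁ ⊕ ⋯ ⊕ L_r` into line bundles: holomorphic bundle
maps `L_j → E` which make each fibre of `E` the direct sum of the fibres of the `L_j`. -/
structure LineDecomposition (E : HolBundle.{u, v, 0} n X (Fin r → ℂ))
    (L : Fin r → HolBundle.{u, w, 0} n X ℂ) where
  incl : ∀ (j : Fin r) (x : X), (L j).Fib x →ₗ[ℂ] E.Fib x
  holomorphic : ∀ (j : Fin r) (U : Opens X) (s : ∀ x, (L j).Fib x),
    (L j).IsHolSection s U → E.IsHolSection (fun x => incl j x (s x)) U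
  bijective : ∀ x : X, Function.Bijective
    (LinearMap.lsum ℂ (fun j => (L j).Fib x) ℂ fun j => incl j x)

/-- The identification `L₁,x ⊕ ⋯ ⊕ L_r,x ≃ E_x`. -/
def LineDecomposition.equiv {E : HolBundle.{u, v, 0} n X (Fin r → ℂ)}
    {L : Fin r → HolBundle.{u, w, 0} n X ℂ} (D : LineDecomposition E L) (x : X) :
    (∀ j, (L j).Fib x) ≃ₗ[ℂ] E.Fib x :=
  LinearEquiv.ofBijective _ (D.bijective x)

/-- The component `Φ_{i,j}` of the Higgs field, a (1,0)-form with values in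
`Hom(L_j, L_i) = L_j⁻¹ L_i`. -/
def LineDecomposition.component [IsManifold 𝓘(ℂ, Cn n) ω X]
    {E : HolBundle.{u, v, 0} n X (Fin r → ℂ)} {L : Fin r → HolBundle.{u, w, 0} n X ℂ}
    (D : LineDecomposition E L) (Φ : HiggsField E) (i j : Fin r)
    (x : X) (a : TangentSpace 𝓘(ℂ, Cn n) x) : (L j).Fib x →ₗ[ℂ] (L i).Fib x :=
  LinearMap.proj i ∘ₗ (D.equiv x).symm.toLinearMap ∘ₗ Φ.toFun x a ∘ₗ D.incl j x

/-- `Φ_{i,j}` does not vanish identically. -/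
def LineDecomposition.ComponentNeZero [IsManifold 𝓘(ℂ, Cn n) ω X]
    {E : HolBundle.{u, v, 0} n X (Fin r → ℂ)} {L : Fin r → HolBundle.{u, w, 0} n X ℂ}
    (D : LineDecomposition E L) (Φ : HiggsField E) (i j : Fin r) : Prop :=
  ∃ (x : X) (a : TangentSpace 𝓘(ℂ, Cn n) x), D.component Φ i j x a ≠ 0

end Decomposition

/-! ### Cones -/

section Cones

variable (K : Type*) [Field K] [LinearOrder K] {r : ℕ}

/-- `∑ K_{≥ 0} (e_i - e_j)`, the sum over the pairs `(i, j)` with `i ≠ j` and `R i j`. -/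
def closedCone (R : Fin r → Fin r → Prop) : Set (Fin r → K) :=
  {y | ∃ a : Fin r → Fin r → K,
    (∀ i j, i ≠ j → R i j → 0 ≤ a i j) ∧ (∀ i j, ¬ (i ≠ j ∧ R i j) → a i j = 0) ∧
    y = ∑ i, ∑ j, a i j • ((Pi.single i 1 - Pi.single j 1 : Fin r → K))}

/-- `∑ K_{> 0} (e_i - e_j)`, the sum over the pairs `(i, j)` with `i ≠ j` and `R i j`
(equal to `{0}` if there is no such pair). -/
def openCone (R : Fin r → Fin r → Prop) : Set (Fin r → K) :=
  {y | ∃ a : Fin r → Fin r → K,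
    (∀ i j, i ≠ j → R i j → 0 < a i j) ∧ (∀ i j, ¬ (i ≠ j ∧ R i j) → a i j = 0) ∧
    y = ∑ i, ∑ j, a i j • ((Pi.single i 1 - Pi.single j 1 : Fin r → K))}

end Cones

end HiggsCone

end

/-!
The theorem reduces to a flow problem on a directed graph with vertices `1, …, r` and an edge from
`j` to `i` whenever `Φ_{i,j} ≠ 0`.

If a set `I` of vertices is closed under following edges, the Higgs field preserves the partial sum
`⨁_{i ∈ I} L_i` (`LineDecomposition.preserves_partialSum`). This is a locally free subsheaf of rank
`#I`, with local bases made up of frames of the `L_i`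
(`LineDecomposition.isBasisOn_partialSum`); its determinant is `⨂_{i ∈ I} L_i`
(`LineDecomposition.isDeterminant_partialSum`), whose degree is `∑_{i ∈ I} m_i`
(`hasDegree_tensorBundle`). Since `deg E = 0`, semistability says that `∑_{i ∈ I} m_i ≤ 0` for all
closed `I`, and stability that the inequality is strict unless `I` is empty or everything.

Additivity of the degree is where analysis enters. The first Chern form is the `∂∂̄` of the logarithm
of the metric in a frame that moves with the point; that it is continuous, so that the integrals
defining the degree converge, follows from its independence of the frame
(`HermMetric.chernMatrix_eq`), which is the vanishing of `∂∂̄ log |g|²` for holomorphic `g ≠ 0`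
(`wirtinger_log_norm_sq`).

It remains to see that a vector `y` with total `0` and nonnegative sums over all closed sets is a
nonnegative combination of the vectors `e_i - e_j` along edges from `j` to `i`
(`mem_closedCone_of_sum_nonneg`). The argument, an induction on the support of `y`, works over any
ordered field and so settles the real and the rational assertions together. If the sums over proper
closed sets are positive, a small multiple of the sum of all edge vectors can be split off from `y`
in advance, which makes all coefficients positive (`mem_openCone_of_sum_pos`).
-/

noncomputable section

namespace HiggsCone

universe u v w

/-! ### Cones spanned by the edge vectors of a directed graph -/

section Combinatorics

variable {r : ℕ} {R : Fin r → Fin r → Prop}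

/-- `I` is closed under the relation `R`, read as a graph with an edge from `j` to `i` whenever
`R i j`. -/
def IsForwardClosed (R : Fin r → Fin r → Prop) (I : Finset (Fin r)) : Prop :=
  ∀ i j, j ∈ I → R i j → i ∈ I

theorem IsForwardClosed.inter {I J : Finset (Fin r)} (hI : IsForwardClosed R I)
    (hJ : IsForwardClosed R J) : IsForwardClosed R (I ∩ J) := fun i j hj h => by
  rw [Finset.mem_inter] at hj ⊢
  exact ⟨hI i j hj.1 h, hJ i j hj.2 h⟩

theorem IsForwardClosed.union {I J : Finset (Fin r)} (hI : IsForwardClosed R I)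
    (hJ : IsForwardClosed R J) : IsForwardClosed R (I ∪ J) := fun i j hj h => by
  rw [Finset.mem_union] at hj ⊢
  exact hj.imp (fun h' => hI i j h' h) (fun h' => hJ i j h' h)

theorem IsForwardClosed.mem_of_reflTransGen {I : Finset (Fin r)} (hI : IsForwardClosed R I)
    {i j : Fin r} (h : Relation.ReflTransGen (fun a b => R b a) j i) (hj : j ∈ I) : i ∈ I := by
  induction h with
  | refl => exact hj
  | tail _ hbc ih => exact hI _ _ ih hbc

variable {K : Type*} [Field K] [LinearOrder K]

theorem zero_mem_closedCone : (0 : Fin r → K) ∈ closedCone K R :=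
  ⟨0, fun _ _ _ _ => le_rfl, fun _ _ _ => rfl, by simp⟩

theorem smul_edge_mem_closedCone {i j : Fin r} (h : R i j) {c : K} (hc : 0 ≤ c) :
    c • (Pi.single i 1 - Pi.single j 1 : Fin r → K) ∈ closedCone K R := by
  classical
  by_cases hij : i = j
  · subst hij
    simpa using zero_mem_closedCone
  refine ⟨fun k l => if k = i ∧ l = j then c else 0, fun k l _ _ => ?_, fun k l hkl => ?_, ?_⟩
  · dsimp only
    split_ifs <;> simp [hc]
  · dsimp only
    rw [if_neg]
    rintro ⟨rfl, rfl⟩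
    exact hkl ⟨hij, h⟩
  · rw [Finset.sum_eq_single i, Finset.sum_eq_single j]
    · simp
    · intro l _ hl
      simp [hl]
    · simp
    · intro k _ hk
      simp [hk]
    · simp

variable [IsStrictOrderedRing K]

theorem add_mem_closedCone {y z : Fin r → K} (hy : y ∈ closedCone K R) (hz : z ∈ closedCone K R) :
    y + z ∈ closedCone K R := by
  obtain ⟨a, ha, ha', rfl⟩ := hy
  obtain ⟨b, hb, hb', rfl⟩ := hz
  refine ⟨a + b, fun i j hij h => add_nonneg (ha i j hij h) (hb i j hij h),
    fun i j h => by simp [ha' i j h, hb' i j h], ?_⟩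
  simp only [Pi.add_apply, add_smul, Finset.sum_add_distrib]

/-- Flow can be sent along a path: the edge vectors of a path from `j` to `i` add up to
`e_i - e_j`. -/
theorem smul_path_mem_closedCone {i j : Fin r}
    (h : Relation.ReflTransGen (fun a b => R b a) j i) {c : K} (hc : 0 ≤ c) :
    c • (Pi.single i 1 - Pi.single j 1 : Fin r → K) ∈ closedCone K R := by
  induction h with
  | refl => simpa using zero_mem_closedCone
  | @tail b i _ hbc ih =>
    have := add_mem_closedCone ih (smul_edge_mem_closedCone hbc hc)
    rwa [← smul_add, sub_add_sub_cancel'] at this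

/-- Membership in the closed cone is a flow problem: `y` is a net inflow along the edges of `R` as
soon as no closed set receives a negative total. Some amount is moved from a vertex `j` with
`y j < 0` to a reachable `i` with `0 < y i`, as much as the hypothesis permits. Then either `y`
vanishes at one more vertex, or the sum over a closed set separating `i` from `j` vanishes and the
problem splits into two with smaller support. -/
theorem mem_closedCone_of_sum_nonneg (y : Fin r → K) (hy : ∑ i, y i = 0)
    (h : ∀ I, IsForwardClosed R I → 0 ≤ ∑ i ∈ I, y i) : y ∈ closedCone K R := by
  classical
  induction hN : (Finset.univ.filter fun i => y i ≠ 0).card using Nat.strong_induction_on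
    generalizing y with
  | _ N ih =>
  subst hN
  have ih' : ∀ z : Fin r → K, ∑ i, z i = 0 → (∀ I, IsForwardClosed R I → 0 ≤ ∑ i ∈ I, z i) →
      (∀ i, y i = 0 → z i = 0) → (∃ i, y i ≠ 0 ∧ z i = 0) → z ∈ closedCone K R := by
    rintro z hz hzI hyz ⟨i, hi, hzi⟩
    refine ih _ (Finset.card_lt_card ?_) z hz hzI rfl
    refine Finset.ssubset_iff_subset_ne.2 ⟨fun k => ?_, fun he => ?_⟩
    · simpa using mt (hyz k)
    · have : i ∈ Finset.univ.filter fun i => z i ≠ 0 := he ▸ by simpa using hi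
      simp [hzi] at this
  by_cases h0 : y = 0
  · rw [h0]
    exact zero_mem_closedCone
  obtain ⟨j, hj⟩ : ∃ j, y j < 0 := by
    by_contra! hc
    exact h0 (funext fun i => (Finset.sum_eq_zero_iff_of_nonneg fun i _ => hc i).1 hy i
      (Finset.mem_univ i))
  obtain ⟨i, hji, hi⟩ : ∃ i, Relation.ReflTransGen (fun a b => R b a) j i ∧ 0 < y i := by
    by_contra! hc
    have hT := h (Finset.univ.filter fun i => Relation.ReflTransGen (fun a b => R b a) j i)
      (fun k l hl hkl => by
        simp only [Finset.mem_filter, Finset.mem_univ, true_and] at hl ⊢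
        exact hl.tail hkl)
    have : ∑ i ∈ Finset.univ.filter (fun i => Relation.ReflTransGen (fun a b => R b a) j i), y i
        < 0 := Finset.sum_neg' (fun k hk => hc k (by simpa using hk))
          ⟨j, by simp [Relation.ReflTransGen.refl], hj⟩
    exact absurd hT this.not_ge
  have hij : i ≠ j := fun he => by
    rw [he] at hi
    exact absurd hi hj.not_gt
  -- `ε` is the largest amount that can be moved.
  obtain ⟨ε, hε0, hεj, hεi, hεI, hε⟩ : ∃ ε : K, 0 ≤ ε ∧ ε ≤ -y j ∧ ε ≤ y i ∧
      (∀ I, IsForwardClosed R I → i ∈ I → j ∉ I → ε ≤ ∑ k ∈ I, y k) ∧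
      (ε = -y j ∨ ε = y i ∨
        ∃ I, IsForwardClosed R I ∧ i ∈ I ∧ j ∉ I ∧ ε = ∑ k ∈ I, y k) := by
    obtain ⟨ε, hmem, hmin⟩ := Finset.exists_min_image
      ({-y j, y i} ∪ (Finset.univ.filter fun I => IsForwardClosed R I ∧ i ∈ I ∧ j ∉ I).image
        fun I => ∑ k ∈ I, y k) id ⟨y i, by simp⟩
    have hε : ε = -y j ∨ ε = y i ∨
        ∃ I, IsForwardClosed R I ∧ i ∈ I ∧ j ∉ I ∧ ε = ∑ k ∈ I, y k := by
      simp only [Finset.mem_union, Finset.mem_insert, Finset.mem_singleton, Finset.mem_image,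
        Finset.mem_filter, Finset.mem_univ, true_and] at hmem
      rcases hmem with (h1 | h1) | ⟨I, ⟨h1, h2, h3⟩, h4⟩
      · exact Or.inl h1
      · exact Or.inr (Or.inl h1)
      · exact Or.inr (Or.inr ⟨I, h1, h2, h3, h4.symm⟩)
    refine ⟨ε, ?_, hmin _ (by simp), hmin _ (by simp), fun I h1 h2 h3 => hmin _ ?_, hε⟩
    · rcases hε with rfl | rfl | ⟨I, h1, -, -, rfl⟩
      · exact (neg_pos.2 hj).le
      · exact hi.le
      · exact h I h1
    · refine Finset.mem_union_right _ (Finset.mem_image.2 ⟨I, ?_, rfl⟩)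
      simp [h1, h2, h3]
  set z : Fin r → K := y - ε • (Pi.single i 1 - Pi.single j 1 : Fin r → K) with hz
  have hyz : y = z + ε • (Pi.single i 1 - Pi.single j 1 : Fin r → K) := by rw [hz, sub_add_cancel]
  have hzsum : ∀ I : Finset (Fin r), ∑ k ∈ I, z k =
      ∑ k ∈ I, y k - ε * ((if i ∈ I then 1 else 0) - if j ∈ I then 1 else 0) := fun I => by
    simp [hz, Finset.sum_sub_distrib, ← Finset.mul_sum]
  have hzi : z i = y i - ε := by simp [hz, hij]
  have hzj : z j = y j + ε := by simp [hz, hij.symm]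
  have hz0 : ∑ k, z k = 0 := by simp [hzsum, hy]
  have hzk : ∀ k, y k = 0 → z k = 0 := fun k hk => by
    have h1 : k ≠ i := fun he => hi.ne' (he ▸ hk)
    have h2 : k ≠ j := fun he => hj.ne (he ▸ hk)
    simp [hz, h1, h2, hk]
  have hzI : ∀ I, IsForwardClosed R I → 0 ≤ ∑ k ∈ I, z k := fun I hI => by
    rw [hzsum]
    by_cases h1 : j ∈ I
    · simpa [h1, hI.mem_of_reflTransGen hji h1] using h I hI
    · by_cases h2 : i ∈ I
      · simpa [h1, h2] using hεI I hI h2 h1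
      · simpa [h1, h2] using h I hI
  rw [hyz]
  refine add_mem_closedCone ?_ (smul_path_mem_closedCone hji hε0)
  rcases hε with he | he | ⟨I, hI, hiI, hjI, he⟩
  · exact ih' z hz0 hzI hzk ⟨j, hj.ne, by rw [hzj, he]; ring⟩
  · exact ih' z hz0 hzI hzk ⟨i, hi.ne', by rw [hzi, he]; ring⟩
  · have hI0 : ∑ k ∈ I, z k = 0 := by simp [hzsum, hiI, hjI, he]
    have hsplit : z = (fun k => if k ∈ I then z k else 0) + fun k => if k ∈ I then 0 else z k := by
      funext k
      by_cases hk : k ∈ I <;> simp [hk]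
    have h1 : ∀ J : Finset (Fin r), ∑ k ∈ J, (if k ∈ I then z k else 0) = ∑ k ∈ J ∩ I, z k :=
      fun J => by rw [Finset.sum_ite_mem]
    have h2 : ∀ J : Finset (Fin r), ∑ k ∈ J, (if k ∈ I then 0 else z k) = ∑ k ∈ J ∪ I, z k :=
      fun J => by
        have h3 := Finset.sum_union_inter (s₁ := J) (s₂ := I) (f := z)
        have h4 : ∑ k ∈ J, z k = ∑ k ∈ J, (if k ∈ I then z k else 0) +
            ∑ k ∈ J, (if k ∈ I then 0 else z k) := by
          rw [← Finset.sum_add_distrib]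
          exact Finset.sum_congr rfl fun k _ => congrFun hsplit k
        rw [h1] at h4
        linear_combination -h4 - h3 - hI0
    rw [hsplit]
    refine add_mem_closedCone (ih' _ ?_ ?_ ?_ ⟨j, hj.ne, by simp [hjI]⟩)
      (ih' _ ?_ ?_ ?_ ⟨i, hi.ne', by simp [hiI]⟩)
    · rw [h1, Finset.univ_inter, hI0]
    · exact fun J hJ => (hzI _ (hJ.inter hI)).trans_eq (h1 J).symm
    · exact fun k hk => by simp [hzk k hk]
    · rw [h2, Finset.union_eq_left.2 (Finset.subset_univ I), hz0]
    · exact fun J hJ => (hzI _ (hJ.union hI)).trans_eq (h2 J).symm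
    · exact fun k hk => by simp [hzk k hk]

/-- Strictly positive sums over the proper closed sets leave room for a small flow along every
edge, which makes all coefficients positive. -/
theorem mem_openCone_of_sum_pos (y : Fin r → K) (hy : ∑ i, y i = 0)
    (h : ∀ I : Finset (Fin r), IsForwardClosed R I → I.Nonempty → I ≠ Finset.univ →
      0 < ∑ i ∈ I, y i) : y ∈ openCone K R := by
  classical
  set W : Fin r → K := ∑ i, ∑ j, (if i ≠ j ∧ R i j then (1 : K) else 0) •
    (Pi.single i 1 - Pi.single j 1 : Fin r → K) with hW
  have hW0 : ∑ k, W k = 0 := by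
    simp only [hW, Finset.sum_apply, Pi.smul_apply, Pi.sub_apply, smul_eq_mul]
    rw [Finset.sum_comm]
    refine Finset.sum_eq_zero fun i _ => ?_
    rw [Finset.sum_comm]
    refine Finset.sum_eq_zero fun j _ => ?_
    rw [← Finset.mul_sum]
    simp
  -- A small positive flow `δ` on every edge keeps the sums over all closed sets nonnegative.
  obtain ⟨δ, hδ, hδI⟩ : ∃ δ : K, 0 < δ ∧ ∀ I : Finset (Fin r), IsForwardClosed R I →
      I.Nonempty → I ≠ Finset.univ → δ * ∑ k ∈ I, W k ≤ ∑ k ∈ I, y k := by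
    obtain ⟨δ, hmem, hmin⟩ := Finset.exists_min_image
      ({1} ∪ (Finset.univ.filter fun I : Finset (Fin r) => IsForwardClosed R I ∧ I.Nonempty ∧
        I ≠ Finset.univ).image
        fun I => (∑ k ∈ I, y k) / (|∑ k ∈ I, W k| + 1)) id ⟨1, by simp⟩
    have hδ : 0 < δ := by
      simp only [Finset.mem_union, Finset.mem_singleton, Finset.mem_image,
        Finset.mem_filter, Finset.mem_univ, true_and] at hmem
      rcases hmem with rfl | ⟨I, ⟨h1, h2, h3⟩, rfl⟩
      · exact one_pos
      · exact div_pos (h I h1 h2 h3) (by positivity)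
    refine ⟨δ, hδ, fun I h1 h2 h3 => ?_⟩
    have h4 : δ ≤ (∑ k ∈ I, y k) / (|∑ k ∈ I, W k| + 1) := hmin _
      (Finset.mem_union_right _ (Finset.mem_image.2 ⟨I, by simp [h1, h2, h3], rfl⟩))
    rw [le_div_iff₀ (by positivity)] at h4
    refine le_trans (mul_le_mul_of_nonneg_left ?_ hδ.le) h4
    linarith [le_abs_self (∑ k ∈ I, W k)]
  have hmem : y - δ • W ∈ closedCone K R := by
    have hs : ∀ I : Finset (Fin r), ∑ k ∈ I, (y - δ • W) k = ∑ k ∈ I, y k - δ * ∑ k ∈ I, W k :=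
      fun I => by simp [Finset.sum_sub_distrib, Finset.mul_sum]
    refine mem_closedCone_of_sum_nonneg _ (by rw [hs, hy, hW0]; simp) fun I hI => ?_
    rw [hs]
    rcases I.eq_empty_or_nonempty with rfl | h1
    · simp
    · by_cases h2 : I = Finset.univ
      · rw [h2, hy, hW0]
        simp
      · exact sub_nonneg.2 (hδI I hI h1 h2)
  obtain ⟨a, ha, ha', hay⟩ := hmem
  refine ⟨fun i j => a i j + δ * (if i ≠ j ∧ R i j then (1 : K) else 0), fun i j hij hR => ?_,
    fun i j hij => ?_, ?_⟩
  · dsimp only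
    rw [if_pos ⟨hij, hR⟩, mul_one]
    exact add_pos_of_nonneg_of_pos (ha i j hij hR) hδ
  · dsimp only
    rw [if_neg hij, ha' i j hij]
    simp
  · simp only [add_smul, Finset.sum_add_distrib, ← hay, mul_smul, ← Finset.smul_sum]
    rw [← hW, sub_add_cancel]

theorem neg_mem_closedCone {γ : Fin r → K} (hγ : ∑ i, γ i = 0)
    (h : ∀ I : Finset (Fin r), IsForwardClosed R I → I.Nonempty → I ≠ Finset.univ →
      ∑ i ∈ I, γ i ≤ 0) : -γ ∈ closedCone K R := by
  refine mem_closedCone_of_sum_nonneg _ (by simp [hγ]) fun I hI => ?_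
  simp only [Pi.neg_apply, Finset.sum_neg_distrib, Left.nonneg_neg_iff]
  rcases I.eq_empty_or_nonempty with rfl | h0
  · simp
  · by_cases h1 : I = Finset.univ
    · rw [h1, hγ]
    · exact h I hI h0 h1

theorem neg_mem_openCone {γ : Fin r → K} (hγ : ∑ i, γ i = 0)
    (h : ∀ I : Finset (Fin r), IsForwardClosed R I → I.Nonempty → I ≠ Finset.univ →
      ∑ i ∈ I, γ i < 0) : -γ ∈ openCone K R :=
  mem_openCone_of_sum_pos _ (by simp [hγ]) fun I hI h0 h1 => by
    simpa [Finset.sum_neg_distrib] using h I hI h0 h1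

end Combinatorics

/-! ### The operator `∂∂̄` -/

section Wirtinger

variable {n : ℕ}

theorem wirtinger_congr {f g : Cn n → ℝ} {z : Cn n} (h : f =ᶠ[𝓝 z] g) (j k : Fin n) :
    wirtinger f z j k = wirtinger g z j k := by
  have key : ∀ b : Cn n, fderiv ℝ (fun y => fderiv ℝ f y b) z =
      fderiv ℝ (fun y => fderiv ℝ g y b) z := fun b => by
    refine EventuallyEq.fderiv_eq ?_
    filter_upwards [h.eventuallyEq_nhds] with y hy
    rw [hy.fderiv_eq]
  simp only [wirtinger, key]

theorem wirtinger_add {f g : Cn n → ℝ} {z : Cn n} (hf : ContDiffAt ℝ 2 f z)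
    (hg : ContDiffAt ℝ 2 g z) (j k : Fin n) :
    wirtinger (fun y => f y + g y) z j k = wirtinger f z j k + wirtinger g z j k := by
  have hd : ∀ {f : Cn n → ℝ}, ContDiffAt ℝ 2 f z → ∀ b : Cn n,
      DifferentiableAt ℝ (fun y => fderiv ℝ f y b) z := fun hf b =>
    ((hf.fderiv_right (m := 1) (by norm_num)).differentiableAt (by norm_num)).clm_apply
      (differentiableAt_const b)
  have hev : ∀ {f : Cn n → ℝ}, ContDiffAt ℝ 2 f z → ∀ᶠ y in 𝓝 z, DifferentiableAt ℝ f y :=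
    fun hf => (hf.eventually (by simp)).mono fun y hy => hy.differentiableAt (by norm_num)
  have key : ∀ b a : Cn n, fderiv ℝ (fun y => fderiv ℝ (fun y => f y + g y) y b) z a =
      fderiv ℝ (fun y => fderiv ℝ f y b) z a + fderiv ℝ (fun y => fderiv ℝ g y b) z a :=
    fun b a => by
      have : (fun y => fderiv ℝ (fun y => f y + g y) y b) =ᶠ[𝓝 z]
          fun y => fderiv ℝ f y b + fderiv ℝ g y b := by
        filter_upwards [hev hf, hev hg] with y h1 h2
        rw [fderiv_fun_add h1 h2, add_apply]
      rw [this.fderiv_eq, fderiv_fun_add (hd hf b) (hd hg b), add_apply]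
  simp only [wirtinger, key]
  push_cast
  ring

theorem wirtinger_sum {ι : Type*} (s : Finset ι) {f : ι → Cn n → ℝ} {z : Cn n}
    (hf : ∀ i ∈ s, ContDiffAt ℝ 2 (f i) z) (j k : Fin n) :
    wirtinger (fun y => ∑ i ∈ s, f i y) z j k = ∑ i ∈ s, wirtinger (f i) z j k := by
  classical
  induction s using Finset.induction_on with
  | empty => simp [wirtinger]
  | insert i s hi ih =>
    have h1 := fun i' h => hf i' (Finset.mem_insert_of_mem (a := i') (b := i) (s := s) h)
    simp only [Finset.sum_insert hi]
    rw [wirtinger_add (hf i (Finset.mem_insert_self i s)) (ContDiffAt.sum h1), ih h1]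

/-- The real part of a holomorphic function is pluriharmonic, because the second derivative of the
function is complex bilinear. -/
theorem wirtinger_re {g : Cn n → ℂ} {z : Cn n} (hg : ContDiffAt ℂ 2 g z) (j k : Fin n) :
    wirtinger (fun y => (g y).re) z j k = 0 := by
  have hd : DifferentiableAt ℂ (fderiv ℂ g) z :=
    (hg.fderiv_right (m := 1) (by norm_num)).differentiableAt (by norm_num)
  have key : ∀ b a : Cn n, fderiv ℝ (fun y => fderiv ℝ (fun y => (g y).re) y b) z a =
      (fderiv ℂ (fderiv ℂ g) z a b).re := fun b a => by
    have h1 : (fun y => fderiv ℝ (fun y => (g y).re) y b) =ᶠ[𝓝 z] fun y => (fderiv ℂ g y b).re := by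
      filter_upwards [hg.eventually (by simp)] with y hy
      have h2 := ((hy.differentiableAt (by norm_num)).hasFDerivAt.restrictScalars ℝ)
      have h3 := (Complex.reCLM.hasFDerivAt (x := g y)).comp y h2
      have h4 : (fun y => (g y).re) = Complex.reCLM ∘ g := rfl
      rw [h4, h3.fderiv]
      rfl
    have h2 : HasFDerivAt (fun y => fderiv ℂ g y b) ((fderiv ℂ (fderiv ℂ g) z).flip b) z := by
      simpa using hd.hasFDerivAt.clm_apply (hasFDerivAt_const b z)
    have h3 := (Complex.reCLM.hasFDerivAt (x := fderiv ℂ g z b)).comp z (h2.restrictScalars ℝ)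
    have h4 : (fun y => (fderiv ℂ g y b).re) = Complex.reCLM ∘ fun y => fderiv ℂ g y b := rfl
    rw [h1.fderiv_eq, h4, h3.fderiv]
    rfl
  have hI : ∀ i : Fin n, (Pi.single i Complex.I : Cn n) = Complex.I • Pi.single i 1 := fun i => by
    rw [← Pi.single_smul, smul_eq_mul, mul_one]
  simp only [wirtinger, key, hI, map_smul, smul_apply, smul_eq_mul]
  simp

/-- Locally `log |g|²` is the real part of the holomorphic function
`log |g z|² + 2 log (g / g z)`. -/
theorem wirtinger_log_norm_sq {g : Cn n → ℂ} {z : Cn n} (hg : ContDiffAt ℂ 2 g z) (h0 : g z ≠ 0)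
    (j k : Fin n) : wirtinger (fun y => Real.log (‖g y‖ ^ 2)) z j k = 0 := by
  have hu : ContDiffAt ℂ 2 (fun y => g y / g z) z := hg.div_const _
  have hs : g z / g z ∈ Complex.slitPlane := by
    rw [div_self h0]
    exact Complex.one_mem_slitPlane
  have hl : ContDiffAt ℂ 2 (fun y => Complex.log (g y / g z)) z :=
    ContDiffAt.comp (g := Complex.log) z (Complex.contDiffAt_log hs) hu
  have hG : ContDiffAt ℂ 2 (fun y => (Real.log (‖g z‖ ^ 2) : ℂ) + 2 * Complex.log (g y / g z)) z :=
    contDiffAt_const.add (contDiffAt_const.mul hl)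
  rw [← wirtinger_re hG j k]
  refine wirtinger_congr ?_ j k
  filter_upwards [hg.continuousAt.eventually_ne h0] with y hy
  have hz' : ‖g z‖ ≠ 0 := norm_ne_zero_iff.2 h0
  have hy' : ‖g y‖ ≠ 0 := norm_ne_zero_iff.2 hy
  simp only [Complex.add_re, Complex.ofReal_re, Complex.mul_re, Complex.re_ofNat, Complex.im_ofNat,
    zero_mul, sub_zero, Complex.log_re, norm_div, Real.log_pow, Real.log_div hy' hz']
  push_cast
  ring

theorem continuousOn_wirtinger {f : Cn n → ℝ} {U : Set (Cn n)} (hU : IsOpen U)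
    (hf : ContDiffOn ℝ ∞ f U) (j k : Fin n) : ContinuousOn (fun z => wirtinger f z j k) U := by
  have key : ∀ b a : Cn n, ContinuousOn (fun z => fderiv ℝ (fun y => fderiv ℝ f y b) z a) U :=
    fun b a => by
      have h1 : ContDiffOn ℝ ∞ (fun y => fderiv ℝ f y b) U :=
        (hf.fderiv_of_isOpen hU (m := ∞) (by simp)).clm_apply contDiffOn_const
      exact ((h1.fderiv_of_isOpen hU (m := ∞) (by simp)).continuousOn).clm_apply continuousOn_const
  unfold wirtinger
  refine ContinuousOn.div_const (ContinuousOn.add ?_ (continuousOn_const.mul ?_)) _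
  · exact Complex.continuous_ofReal.comp_continuousOn ((key _ _).add (key _ _))
  · exact Complex.continuous_ofReal.comp_continuousOn ((key _ _).sub (key _ _))

end Wirtinger

/-! ### Transition functions of line bundles -/

section Transition

variable {n : ℕ} {X : Type u} [TopologicalSpace X] [ChartedSpace (Cn n) X]
  (L : HolBundle.{u, v, 0} n X ℂ)

/-- The domain of the preferred local trivialization of a bundle around `x`. -/
def HolBundle.base {F : Type w} [NormedAddCommGroup F] [NormedSpace ℂ F]
    (E : HolBundle.{u, v, w} n X F) (x : X) : Opens X :=
  ⟨(trivializationAt F E.Fib x).baseSet, (trivializationAt F E.Fib x).open_baseSet⟩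

theorem HolBundle.mem_base {F : Type w} [NormedAddCommGroup F] [NormedSpace ℂ F]
    (E : HolBundle.{u, v, w} n X F) (x : X) : x ∈ E.base x :=
  FiberBundle.mem_baseSet_trivializationAt' x

/-- The holomorphic function relating the preferred frames of a line bundle around `x` and `x'`. -/
def HolBundle.transition (x x' y : X) : ℂ :=
  (trivializationAt ℂ L.Fib x).coordChangeL ℂ (trivializationAt ℂ L.Fib x') y 1

variable {L}

theorem HolBundle.frame_eq_transition_smul {x x' y : X} (hx : y ∈ L.base x) (hx' : y ∈ L.base x') :
    L.frame x y = L.transition x x' y • L.frame x' y := by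
  have h1 := (trivializationAt ℂ L.Fib x).coordChangeL_apply (R := ℂ)
    (trivializationAt ℂ L.Fib x') ⟨hx, hx'⟩ 1
  have h2 := (trivializationAt ℂ L.Fib x').symmₗ_linearMapAt (R := ℂ) hx' (L.frame x y)
  rw [Trivialization.coe_linearMapAt_of_mem _ hx'] at h2
  rw [← h2, HolBundle.transition, h1]
  rw [HolBundle.frame, HolBundle.frame, ← Trivialization.symmₗ_apply (R := ℂ) _ hx' 1, ← map_smul,
    smul_eq_mul, mul_one]

theorem HolBundle.trivializationAt_frame {x y : X} (hx : y ∈ L.base x) :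
    (trivializationAt ℂ L.Fib x ⟨y, L.frame x y⟩).2 = 1 := by
  rw [HolBundle.frame, Trivialization.apply_mk_symm _ hx]

theorem HolBundle.smul_frame {x y : X} (hx : y ∈ L.base x) (e : L.Fib y) :
    (trivializationAt ℂ L.Fib x ⟨y, e⟩).2 • L.frame x y = e := by
  have h2 := (trivializationAt ℂ L.Fib x).symmₗ_linearMapAt (R := ℂ) hx e
  rw [Trivialization.coe_linearMapAt_of_mem _ hx] at h2
  rw [HolBundle.frame, ← Trivialization.symmₗ_apply (R := ℂ) _ hx 1, ← map_smul, smul_eq_mul,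
    mul_one, h2]

theorem HolBundle.frame_ne_zero {x y : X} (hx : y ∈ L.base x) : L.frame x y ≠ 0 := fun h => by
  have h1 := HolBundle.trivializationAt_frame hx
  have h2 := congrFun (Trivialization.coe_linearMapAt_of_mem (R := ℂ) _ hx) (0 : L.Fib y)
  rw [h, ← h2, map_zero] at h1
  exact zero_ne_one h1

theorem HolBundle.transition_ne_zero {x x' y : X} (hx : y ∈ L.base x) (hx' : y ∈ L.base x') :
    L.transition x x' y ≠ 0 := fun h =>
  HolBundle.frame_ne_zero hx (by rw [frame_eq_transition_smul hx hx', h, zero_smul])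

theorem HolBundle.transition_self {x y : X} (hx : y ∈ L.base x) : L.transition x x y = 1 :=
  smul_left_injective ℂ (HolBundle.frame_ne_zero hx) (by
    dsimp only
    rw [← HolBundle.frame_eq_transition_smul hx hx, one_smul])

theorem HolBundle.transition_mul {x x' x'' y : X} (hx : y ∈ L.base x) (hx' : y ∈ L.base x')
    (hx'' : y ∈ L.base x'') :
    L.transition x' x'' y * L.transition x x' y = L.transition x x'' y :=
  smul_left_injective ℂ (HolBundle.frame_ne_zero hx'') (by
    dsimp only
    rw [← HolBundle.frame_eq_transition_smul hx hx'', mul_comm, mul_smul,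
      ← HolBundle.frame_eq_transition_smul hx' hx'', ← HolBundle.frame_eq_transition_smul hx hx'])

variable (L)

theorem HolBundle.isHolFun_transition (x x' : X) :
    IsHolFun n (L.transition x x') (L.base x ∩ L.base x' : Set X) := by
  have h := contMDiffOn_coordChangeL (IB := 𝓘(ℂ, Cn n)) (n := ω)
    (trivializationAt ℂ L.Fib x) (trivializationAt ℂ L.Fib x')
  exact h.clm_apply contMDiffOn_const

theorem HolBundle.isHolSection_frame (x : X) : L.IsHolSection (L.frame x) (L.base x) :=
  ((trivializationAt ℂ L.Fib x).contMDiffOn_section_baseSet_iff).2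
    (contMDiffOn_const.congr fun _ hy => HolBundle.trivializationAt_frame hy)

end Transition

/-- A holomorphic function, read in a chart. -/
theorem IsHolFun.contDiffOn_chart {n : ℕ} {X : Type u} [TopologicalSpace X]
    [ChartedSpace (Cn n) X] [IsManifold 𝓘(ℂ, Cn n) ω X] {f : X → ℂ} {U : Set X}
    (hf : IsHolFun n f U) (c : X) :
    ContDiffOn ℂ ω (fun z => f ((chartAt (Cn n) c).symm z))
      ((chartAt (Cn n) c).target ∩ (chartAt (Cn n) c).symm ⁻¹' U) := by
  rw [← contMDiffOn_iff_contDiffOn]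
  exact ContMDiffOn.comp' hf (contMDiffOn_chart_symm (I := 𝓘(ℂ, Cn n)) (n := ω))

/-! ### Integrability of degree densities -/

section Density

variable {n : ℕ} {X : Type u} [TopologicalSpace X] [ChartedSpace (Cn n) X]

variable (n) in
theorem isOpen_chart_preimage (c : X) (U : Opens X) :
    IsOpen ((chartAt (Cn n) c).target ∩ (chartAt (Cn n) c).symm ⁻¹' U) :=
  (chartAt (Cn n) c).symm.isOpen_inter_preimage U.isOpen

theorem HermMetric.contDiffOn_log {L : HolBundle.{u, v, 0} n X ℂ} (h : HermMetric L) (x c : X) :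
    ContDiffOn ℝ ∞
      (fun z => Real.log (h.normSq ((chartAt (Cn n) c).symm z) (L.frame x _)))
      ((chartAt (Cn n) c).target ∩ (chartAt (Cn n) c).symm ⁻¹' L.base x) :=
  (h.smooth x c).log fun _ hz => (h.normSq_pos _ _ (HolBundle.frame_ne_zero hz.2)).ne'

/-- The first Chern form may be computed with any of the preferred frames: two of them differ by a
holomorphic factor `g`, and `∂∂̄ log |g|² = 0`. -/
theorem HermMetric.chernMatrix_eq [IsManifold 𝓘(ℂ, Cn n) ω X] {L : HolBundle.{u, v, 0} n X ℂ}
    (h : HermMetric L) {x c : X} {z : Cn n} (hz : z ∈ (chartAt (Cn n) c).target)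
    (hx : (chartAt (Cn n) c).symm z ∈ L.base x) (j k : Fin n) :
    h.chernMatrix c z j k = -(1 / (2 * (Real.pi : ℂ))) *
      wirtinger (fun y => Real.log (h.normSq ((chartAt (Cn n) c).symm y) (L.frame x _))) z j k := by
  set φ := chartAt (Cn n) c
  set x' := φ.symm z
  have hopen := isOpen_chart_preimage n c (L.base x ⊓ L.base x')
  have hmem : z ∈ φ.target ∩ φ.symm ⁻¹' (L.base x ⊓ L.base x' : Opens X) :=
    ⟨hz, hx, L.mem_base x'⟩
  have hg : ContDiffAt ℂ 2 (fun y => L.transition x' x (φ.symm y)) z :=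
    (((L.isHolFun_transition x' x).contDiffOn_chart c).contDiffAt
      (hopen.mem_nhds hmem |> fun h => by
        filter_upwards [h] with y hy using ⟨hy.1, hy.2.2, hy.2.1⟩)).of_le le_top
  have hlog : ContDiffAt ℝ 2 (fun y => Real.log (h.normSq (φ.symm y) (L.frame x _))) z :=
    ((h.contDiffOn_log x c).contDiffAt ((isOpen_chart_preimage n c (L.base x)).mem_nhds
      ⟨hz, hx⟩)).of_le (WithTop.coe_le_coe.2 (le_top (a := (2 : ℕ∞))))
  have hg0 : L.transition x' x (φ.symm z) ≠ 0 :=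
    HolBundle.transition_ne_zero (L.mem_base x') hx
  have hglog : ContDiffAt ℝ 2 (fun y => Real.log (‖L.transition x' x (φ.symm y)‖ ^ 2)) z :=
    ((hg.restrict_scalars ℝ).norm_sq ℝ).log (by simpa using hg0)
  rw [HermMetric.chernMatrix, Matrix.of_apply]
  congr 1
  have : (fun y => Real.log (h.normSq (φ.symm y) (L.frame x' _))) =ᶠ[𝓝 z]
      fun y => Real.log (‖L.transition x' x (φ.symm y)‖ ^ 2) +
        Real.log (h.normSq (φ.symm y) (L.frame x _)) := by
    filter_upwards [hopen.mem_nhds hmem] with y hy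
    have h1 := HolBundle.transition_ne_zero hy.2.2 hy.2.1
    rw [HolBundle.frame_eq_transition_smul hy.2.2 hy.2.1, h.normSq_smul,
      Real.log_mul (by simpa using h1) (h.normSq_pos _ _ (HolBundle.frame_ne_zero hy.2.1)).ne']
  rw [wirtinger_congr this, wirtinger_add hglog hlog, wirtinger_log_norm_sq hg hg0, zero_add]

theorem HermMetric.continuousOn_chernMatrix [IsManifold 𝓘(ℂ, Cn n) ω X]
    {L : HolBundle.{u, v, 0} n X ℂ} (h : HermMetric L) (c : X) :
    ContinuousOn (h.chernMatrix c) (chartAt (Cn n) c).target := by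
  refine continuousOn_pi.2 fun j => continuousOn_pi.2 fun k z hz => ?_
  set x := (chartAt (Cn n) c).symm z
  have hU := isOpen_chart_preimage n c (L.base x)
  have hmem : z ∈ (chartAt (Cn n) c).target ∩ (chartAt (Cn n) c).symm ⁻¹' L.base x :=
    ⟨hz, L.mem_base x⟩
  have hc := (continuousOn_const (c := -(1 / (2 * (Real.pi : ℂ))))).mul
    (continuousOn_wirtinger hU (h.contDiffOn_log x c) j k)
  refine ((hc.congr fun y hy => ?_).continuousAt (hU.mem_nhds hmem)).continuousWithinAt
  exact h.chernMatrix_eq hy.1 hy.2 j k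

theorem continuousOn_degreeDensity [IsManifold 𝓘(ℂ, Cn n) ω X] (κ : KaehlerForm n X)
    {L : HolBundle.{u, v, 0} n X ℂ} (h : HermMetric L) (c : X) :
    ContinuousOn (degreeDensity κ h c) (chartAt (Cn n) c).target := by
  have hev : ∀ a : Fin 2 → Cn n, ContinuousOn (fun z => formInChart κ.toFun c z a)
      (chartAt (Cn n) c).target := fun a =>
    (continuous_eval_const a).comp_continuousOn (κ.smooth c).continuousOn
  have hco : ContinuousOn (fun z => coeffMatrix (formInChart κ.toFun c z))
      (chartAt (Cn n) c).target := by
    refine continuousOn_pi.2 fun j => continuousOn_pi.2 fun k => ?_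
    simp only [coeffMatrix, Matrix.of_apply]
    exact ((Complex.continuous_ofReal.comp_continuousOn (hev _)).sub
      (continuousOn_const.mul (Complex.continuous_ofReal.comp_continuousOn (hev _)))).div_const _
  refine continuousOn_const.mul (Complex.continuous_re.comp_continuousOn ?_)
  have hadj := (continuous_id (X := Matrix (Fin n) (Fin n) ℂ)).matrix_adjugate.comp_continuousOn hco
  have htr := (continuous_id (X := Matrix (Fin n) (Fin n) ℂ)).matrix_trace
  exact htr.comp_continuousOn (hadj.mul (h.continuousOn_chernMatrix c))

variable [CompactSpace X] [T2Space X]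

/-- The integrand is continuous on the chart and vanishes off a compact subset of it. -/
theorem integrableOn_chartPartition_mul {η : Cn n → ℝ} (c : X)
    (hη : ContinuousOn η (chartAt (Cn n) c).target) :
    IntegrableOn (fun z => chartPartition n X c ((chartAt (Cn n) c).symm z) * η z)
      (chartAt (Cn n) c).target := by
  set φ := chartAt (Cn n) c
  have hsub : tsupport (chartPartition n X c) ⊆ φ.source :=
    (exists_chartPartition n X).choose_spec c
  have hK : IsCompact (φ '' tsupport (chartPartition n X c)) :=
    (isClosed_tsupport _).isCompact.image_of_continuousOn (φ.continuousOn.mono hsub)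
  have hKt : φ '' tsupport (chartPartition n X c) ⊆ φ.target := by
    rintro _ ⟨x, hx, rfl⟩
    exact φ.map_source (hsub hx)
  have hcont : ContinuousOn (fun z => chartPartition n X c (φ.symm z) * η z) φ.target :=
    ((chartPartition n X c).continuous.comp_continuousOn φ.symm.continuousOn).mul hη
  refine ((hcont.mono hKt).integrableOn_compact hK).of_forall_sdiff_eq_zero
    φ.open_target.measurableSet fun z hz => ?_
  rw [image_eq_zero_of_notMem_tsupport (f := chartPartition n X c), zero_mul]
  exact fun hs => hz.2 ⟨_, hs, φ.right_inv hz.1⟩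

theorem integralForm_sum {ι : Type*} (s : Finset ι) {η : ι → X → Cn n → ℝ}
    (hη : ∀ i ∈ s, ∀ c, ContinuousOn (η i c) (chartAt (Cn n) c).target) {θ : X → Cn n → ℝ}
    (hθ : ∀ c, ∀ z ∈ (chartAt (Cn n) c).target, θ c z = ∑ i ∈ s, η i c z) :
    integralForm θ = ∑ i ∈ s, integralForm (η i) := by
  have hfin : {c : X | (Function.support (chartPartition n X c)).Nonempty}.Finite :=
    (chartPartition n X).locallyFinite.finite_nonempty_of_compact
  unfold integralForm
  rw [← finsum_sum_comm]
  · refine finsum_congr fun c => ?_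
    rw [← integral_finsetSum s fun i hi => integrableOn_chartPartition_mul c (hη i hi c)]
    refine setIntegral_congr_fun (chartAt (Cn n) c).open_target.measurableSet fun z hz => ?_
    simp only [hθ c z hz, Finset.mul_sum]
  · refine fun i _ => hfin.subset fun c hc => ?_
    by_contra h
    have h0 : ∀ x, chartPartition n X c x = 0 := by
      simpa [Set.Nonempty] using h
    exact hc (by simp [h0])

end Density

/-! ### Tensor products of line bundles -/

section Tensor

variable {n : ℕ} {X : Type u} [TopologicalSpace X] [ChartedSpace (Cn n) X]
  {ι : Type} [Fintype ι] (L : ι → HolBundle.{u, v, 0} n X ℂ)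

/-- The gluing data of the tensor product `⨂ L i`: over the points where the preferred frames of all
the `L i` around `x` and `x'` are defined, the transition functions are multiplied. -/
def tensorCore : VectorBundleCore ℂ X ℂ X where
  baseSet x := ⋂ i, (L i).base x
  isOpen_baseSet x := isOpen_iInter_of_finite fun i => ((L i).base x).isOpen
  indexAt x := x
  mem_baseSet_at x := mem_iInter.2 fun i => (L i).mem_base x
  coordChange x x' y := (∏ i, (L i).transition x x' y) • ContinuousLinearMap.id ℂ ℂ
  coordChange_self x y hy a := by
    simp [fun i => HolBundle.transition_self (mem_iInter.1 hy i)]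
  continuousOn_coordChange x x' := by
    refine ContinuousOn.smul (f := fun y => ∏ i, (L i).transition x x' y)
      (continuousOn_finsetProd _ fun i _ => ?_) continuousOn_const
    exact ((L i).isHolFun_transition x x').continuousOn.mono
      (inter_subset_inter (iInter_subset _ i) (iInter_subset _ i))
  coordChange_comp x x' x'' y hy a := by
    have h := fun i => HolBundle.transition_mul (mem_iInter.1 hy.1.1 i) (mem_iInter.1 hy.1.2 i)
      (mem_iInter.1 hy.2 i)
    simp only [smul_apply, ContinuousLinearMap.id_apply, smul_eq_mul,
      ← mul_assoc, ← Finset.prod_mul_distrib, h]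

instance : (tensorCore L).IsContMDiff 𝓘(ℂ, Cn n) ω where
  contMDiffOn_coordChange x x' := by
    have h : ContMDiffOn 𝓘(ℂ, Cn n) 𝓘(ℂ) ω (fun y => ∏ i, (L i).transition x x' y)
        ((tensorCore L).baseSet x ∩ (tensorCore L).baseSet x') :=
      contMDiffOn_finsetProd fun i _ => ((L i).isHolFun_transition x x').mono
        (inter_subset_inter (iInter_subset _ i) (iInter_subset _ i))
    exact h.smul contMDiffOn_const

/-- The tensor product `⨂ L i` of finitely many line bundles. Its fibre at `y` is `ℂ`, where `1`
stands for the tensor product of the preferred frames around `y`. -/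
def tensorBundle : HolBundle.{u, 0, 0} n X ℂ where
  Fib := (tensorCore L).Fiber

/-- The identification of the fibres of `⨂ L i` with `ℂ`. -/
def tensorFibEquiv (y : X) : (tensorBundle L).Fib y ≃ₗ[ℂ] ℂ := LinearEquiv.refl ℂ ℂ

theorem mem_tensorBundle_base {x y : X} :
    y ∈ (tensorBundle L).base x ↔ ∀ i, y ∈ (L i).base x :=
  mem_iInter (s := fun i => ((L i).base x : Set X))

theorem tensorFibEquiv_frame {x y : X} (hy : ∀ i, y ∈ (L i).base x) :
    tensorFibEquiv L y ((tensorBundle L).frame x y) = ∏ i, (L i).transition x y y := by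
  have hb : y ∈ (trivializationAt ℂ (tensorCore L).Fiber x).baseSet :=
    (mem_tensorBundle_base L).2 hy
  have h1 := (tensorCore L).trivializationAt_symmL hb
  have h2 := congrArg (fun f => f 1) h1
  simp only [Trivialization.symmL_apply _ hb] at h2
  change (trivializationAt ℂ (tensorCore L).Fiber x).symm y 1 = _
  rw [h2]
  change (∏ i, (L i).transition x y y) * 1 = _
  rw [mul_one]

variable {L}

theorem norm_sq_tensorFibEquiv_frame_mul_prod (h : ∀ i, HermMetric (L i)) {x y : X}
    (hy : ∀ i, y ∈ (L i).base x) :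
    ‖tensorFibEquiv L y ((tensorBundle L).frame x y)‖ ^ 2 *
      ∏ i, (h i).normSq y ((L i).frame y y) = ∏ i, (h i).normSq y ((L i).frame x y) := by
  rw [tensorFibEquiv_frame L hy, norm_prod, ← Finset.prod_pow, ← Finset.prod_mul_distrib]
  refine Finset.prod_congr rfl fun i _ => ?_
  rw [HolBundle.frame_eq_transition_smul (hy i) ((L i).mem_base _), (h i).normSq_smul]

/-- The product of Hermitian metrics on line bundles, a metric on their tensor product. -/
def tensorMetric (h : ∀ i, HermMetric (L i)) : HermMetric (tensorBundle L) where
  normSq y e := ‖tensorFibEquiv L y e‖ ^ 2 * ∏ i, (h i).normSq y ((L i).frame y y)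
  normSq_smul y a e := by
    rw [map_smul, norm_smul, mul_pow, mul_assoc]
  normSq_pos y e he := by
    refine mul_pos (pow_pos (norm_pos_iff.2 ((map_ne_zero_iff _
      (tensorFibEquiv L y).injective).2 he)) 2) (Finset.prod_pos fun i _ => ?_)
    exact (h i).normSq_pos _ _ (HolBundle.frame_ne_zero ((L i).mem_base y))
  smooth x c := by
    refine (contDiffOn_prod (t := Finset.univ) fun i _ => ((h i).smooth x c).mono
      (inter_subset_inter_right _ (preimage_mono (iInter_subset _ i)))).congr fun z hz => ?_
    exact norm_sq_tensorFibEquiv_frame_mul_prod h ((mem_tensorBundle_base L).1 hz.2)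

theorem tensorMetric_frame (h : ∀ i, HermMetric (L i)) {x y : X} (hy : ∀ i, y ∈ (L i).base x) :
    (tensorMetric h).normSq y ((tensorBundle L).frame x y) =
      ∏ i, (h i).normSq y ((L i).frame x y) :=
  norm_sq_tensorFibEquiv_frame_mul_prod h hy

theorem chernMatrix_tensorMetric (h : ∀ i, HermMetric (L i)) {c : X} {z : Cn n}
    (hz : z ∈ (chartAt (Cn n) c).target) :
    (tensorMetric h).chernMatrix c z = ∑ i, (h i).chernMatrix c z := by
  ext j k
  set x := (chartAt (Cn n) c).symm z
  have hmem : x ∈ (tensorBundle L).base x := (tensorBundle L).mem_base x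
  have hev : (fun y => Real.log ((tensorMetric h).normSq ((chartAt (Cn n) c).symm y)
      ((tensorBundle L).frame x _))) =ᶠ[𝓝 z]
      fun y => ∑ i, Real.log ((h i).normSq ((chartAt (Cn n) c).symm y) ((L i).frame x _)) := by
    filter_upwards [(isOpen_chart_preimage n c ((tensorBundle L).base x)).mem_nhds ⟨hz, hmem⟩]
      with y hy
    have hy' := (mem_tensorBundle_base L).1 hy.2
    rw [tensorMetric_frame h hy', Real.log_prod]
    exact fun i _ => ((h i).normSq_pos _ _ (HolBundle.frame_ne_zero (hy' i))).ne'
  rw [Matrix.sum_apply]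
  simp only [HermMetric.chernMatrix, Matrix.of_apply]
  rw [wirtinger_congr hev, wirtinger_sum, Finset.mul_sum]
  exact fun i _ => (((h i).contDiffOn_log x c).contDiffAt
    ((isOpen_chart_preimage n c ((L i).base x)).mem_nhds ⟨hz, (L i).mem_base x⟩)).of_le
      (WithTop.coe_le_coe.2 (le_top (a := (2 : ℕ∞))))

/-- Additivity of the degree. The densities add up because the logarithms of the metrics do; that
their integrals do as well requires integrability, since a divergent integral would count as `0`. -/
theorem hasDegree_tensorBundle [IsManifold 𝓘(ℂ, Cn n) ω X] [CompactSpace X] [T2Space X]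
    (κ : KaehlerForm n X) {d : ι → ℝ} (hd : ∀ i, HasDegree κ (L i) (d i)) :
    HasDegree κ (tensorBundle L) (∑ i, d i) := by
  choose h hh using hd
  refine ⟨tensorMetric h, ?_⟩
  rw [integralForm_sum Finset.univ (η := fun i => degreeDensity κ (h i))
    fun i _ c => continuousOn_degreeDensity κ (h i) c]
  · exact Finset.sum_congr rfl fun i _ => hh i
  · intro c z hz
    simp only [degreeDensity, chernMatrix_tensorMetric h hz, Finset.mul_sum, Matrix.trace_sum,
      Complex.re_sum]

end Tensor

/-! ### Partial sums of a decomposition into line bundles -/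

section PartialSum

variable {n : ℕ} {X : Type u} [TopologicalSpace X] [ChartedSpace (Cn n) X] {r : ℕ}
  {E : HolBundle.{u, v, 0} n X (Fin r → ℂ)} {L : Fin r → HolBundle.{u, w, 0} n X ℂ}
  (D : LineDecomposition E L)

theorem isAnalyticCodimGeTwo_empty : IsAnalyticCodimGeTwo n (∅ : Set X) :=
  ⟨isClosed_empty, fun x => ⟨⊤, trivial, 1, fun _ _ => 1, fun _ => contMDiffOn_const, by simp⟩,
    fun x hx => absurd hx (notMem_empty x)⟩

namespace LineDecomposition

/-- The component in `L j` of a vector of `E`. -/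
def coord (j : Fin r) (x : X) : E.Fib x →ₗ[ℂ] (L j).Fib x :=
  LinearMap.proj j ∘ₗ (D.equiv x).symm.toLinearMap

theorem equiv_apply (x : X) (a : ∀ j, (L j).Fib x) : D.equiv x a = ∑ j, D.incl j x (a j) := by
  simp [LineDecomposition.equiv, LinearMap.lsum_apply]

theorem sum_incl_coord (x : X) (e : E.Fib x) : ∑ j, D.incl j x (D.coord j x e) = e := by
  have h := D.equiv_apply x ((D.equiv x).symm e)
  rw [LinearEquiv.apply_symm_apply] at h
  exact h.symm

theorem coord_sum_incl (x : X) (a : ∀ j, (L j).Fib x) (i : Fin r) :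
    D.coord i x (∑ j, D.incl j x (a j)) = a i := by
  rw [← D.equiv_apply]
  simp [coord]

theorem coord_incl_of_ne {i j : Fin r} (hij : i ≠ j) (x : X) (a : (L j).Fib x) :
    D.coord i x (D.incl j x a) = 0 := by
  classical
  have h := D.coord_sum_incl x (Pi.single j a) i
  rwa [Finset.sum_eq_single j (fun k _ hk => by rw [Pi.single_eq_of_ne hk, map_zero]) (by simp),
    Pi.single_eq_same, Pi.single_eq_of_ne hij] at h

/-- The holomorphic frame of `E` made up of the preferred frames of the `L j` around `x`. -/
def frame (j : Fin r) (x y : X) : E.Fib y := D.incl j y ((L j).frame x y)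

/-- The open set on which the preferred frames of all the `L j` around `x` are defined. -/
def frameDomain (_D : LineDecomposition E L) (x : X) : Opens X :=
  ⟨⋂ j, (L j).base x, isOpen_iInter_of_finite fun j => ((L j).base x).isOpen⟩

theorem mem_frameDomain (x : X) : x ∈ D.frameDomain x :=
  mem_iInter.2 fun j => (L j).mem_base x

variable {D} in
theorem mem_base_of_mem_frameDomain {x y : X} (hy : y ∈ D.frameDomain x) (j : Fin r) :
    y ∈ (L j).base x := mem_iInter.1 hy j

theorem isHolSection_frame (j : Fin r) (x : X) :
    E.IsHolSection (D.frame j x) (D.frameDomain x) :=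
  D.holomorphic j _ _ (((L j).isHolSection_frame x).mono (iInter_subset _ j))

/-- The coefficient of a section of `E` along `D.frame j x`; it is meaningful on
`D.frameDomain x`. -/
def coeff (j : Fin r) (x : X) (t : ∀ y, E.Fib y) (y : X) : ℂ :=
  (trivializationAt ℂ (L j).Fib x ⟨y, D.coord j y (t y)⟩).2

theorem coeff_smul_frame {x y : X} (hy : y ∈ D.frameDomain x) (j : Fin r) (t : ∀ y, E.Fib y) :
    D.coeff j x t y • D.frame j x y = D.incl j y (D.coord j y (t y)) := by
  rw [frame, ← map_smul, coeff, HolBundle.smul_frame (mem_base_of_mem_frameDomain hy j)]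

theorem sum_coeff_smul_frame {x y : X} (hy : y ∈ D.frameDomain x) (t : ∀ y, E.Fib y) :
    ∑ j, D.coeff j x t y • D.frame j x y = t y := by
  simp only [D.coeff_smul_frame hy, D.sum_incl_coord]

theorem eq_zero_of_sum_smul_frame_eq_zero {x y : X} (hy : y ∈ D.frameDomain x) {a : Fin r → ℂ}
    (h : ∑ j, a j • D.frame j x y = 0) : a = 0 := by
  funext j
  have h1 := D.coord_sum_incl y (fun j => a j • (L j).frame x y) j
  simp only [map_smul] at h1
  change D.coord j y (∑ j, a j • D.frame j x y) = _ at h1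
  rw [h, map_zero] at h1
  exact (smul_eq_zero.1 h1.symm).resolve_right
    (HolBundle.frame_ne_zero (mem_base_of_mem_frameDomain hy j))

/-- The coefficients are obtained by inverting the matrix, holomorphic in the base point, of the
frame in a local trivialization of `E`. -/
theorem isHolFun_coeff {x : X} {V : Opens X} (hV : V ≤ D.frameDomain x) {t : ∀ y, E.Fib y}
    (ht : E.IsHolSection t V) (j : Fin r) : IsHolFun n (D.coeff j x t) (V : Set X) := by
  intro p hp
  refine ContMDiffAt.contMDiffWithinAt ?_
  set e := trivializationAt (Fin r → ℂ) E.Fib p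
  have hpe : p ∈ e.baseSet := E.mem_base p
  have hsec : ∀ {s : ∀ y, E.Fib y}, E.IsHolSection s V →
      ContMDiffAt 𝓘(ℂ, Cn n) 𝓘(ℂ, Fin r → ℂ) ω (fun y => (e ⟨y, s y⟩).2) p := fun hs =>
    (e.contMDiffAt_section_iff hpe).1 (hs.contMDiffAt (V.isOpen.mem_nhds hp))
  -- `B y` takes coefficients along the frame to coordinates in the trivialization `e` of `E`.
  let B : X → (Fin r → ℂ) →L[ℂ] (Fin r → ℂ) := fun y =>
    ∑ i, (ContinuousLinearMap.proj (R := ℂ) (φ := fun _ : Fin r => ℂ) i).smulRight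
      (e ⟨y, D.frame i x y⟩).2
  have hBapp : ∀ y ∈ e.baseSet, ∀ a : Fin r → ℂ,
      B y a = e.linearMapAt ℂ y (∑ i, a i • D.frame i x y) := fun y hy a => by
    simp [B, e.coe_linearMapAt_of_mem (R := ℂ) hy]
  have hBinj : ∀ y ∈ e.baseSet, y ∈ V → (B y).IsInvertible := fun y hy hyV => by
    have hinj : Function.Injective (B y : (Fin r → ℂ) →ₗ[ℂ] (Fin r → ℂ)) := by
      rw [← LinearMap.ker_eq_bot, LinearMap.ker_eq_bot']
      intro a ha
      change B y a = 0 at ha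
      rw [hBapp y hy] at ha
      refine D.eq_zero_of_sum_smul_frame_eq_zero (hV hyV) ?_
      rw [← e.symmₗ_linearMapAt (R := ℂ) hy (∑ j, a j • D.frame j x y), ha, map_zero]
    exact ⟨(LinearEquiv.ofInjectiveEndo _ hinj).toContinuousLinearEquiv, by ext; rfl⟩
  have hB : ContMDiffAt 𝓘(ℂ, Cn n) 𝓘(ℂ, (Fin r → ℂ) →L[ℂ] (Fin r → ℂ)) ω B p := by
    refine contMDiffAt_finsetSum fun i _ => ?_
    have hi := hsec ((D.isHolSection_frame i x).mono hV)
    exact (((ContinuousLinearMap.smulRightL ℂ (Fin r → ℂ) (Fin r → ℂ)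
      (ContinuousLinearMap.proj i)).contMDiff (n := ω)).contMDiffAt).comp p hi
  have hinv : ContMDiffAt 𝓘(ℂ, Cn n) 𝓘(ℂ, (Fin r → ℂ) →L[ℂ] (Fin r → ℂ)) ω
      (fun y => (B y).inverse) p :=
    ((hBinj p hpe hp).contDiffAt_map_inverse.contMDiffAt).comp p hB
  have hc : ContMDiffAt 𝓘(ℂ, Cn n) 𝓘(ℂ, Fin r → ℂ) ω
      (fun y => (B y).inverse (e ⟨y, t y⟩).2) p := hinv.clm_apply (hsec ht)
  have hcj : ContMDiffAt 𝓘(ℂ, Cn n) 𝓘(ℂ) ω (fun y => (B y).inverse (e ⟨y, t y⟩).2 j) p :=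
    contMDiffAt_pi_space.1 hc j
  refine hcj.congr_of_eventuallyEq ?_
  filter_upwards [V.isOpen.mem_nhds hp, e.open_baseSet.mem_nhds hpe] with y hyV hye
  have h1 : B y (fun j => D.coeff j x t y) = (e ⟨y, t y⟩).2 := by
    rw [hBapp y hye, D.sum_coeff_smul_frame (hV hyV), e.coe_linearMapAt_of_mem hye]
  rw [← h1]
  obtain ⟨B', hB'⟩ := hBinj y hye hyV
  rw [← hB', ContinuousLinearMap.inverse_equiv]
  simp

/-- The subsheaf `⨁_{i ∈ I} L i` of `E`. -/
def partialSum (I : Finset (Fin r)) : HolSubsheaf E where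
  mem U s := E.IsHolSection s U ∧ ∀ x ∈ U, ∀ i ∉ I, D.coord i x (s x) = 0
  holomorphic _ _ h := h.1
  congr U s t hst hs := ⟨(HolSubsheaf.whole E).congr U s t hst hs.1,
    fun x hx i hi => by rw [← hst x hx, hs.2 x hx i hi]⟩
  zero U := ⟨(HolSubsheaf.whole E).zero U, fun x _ i _ => map_zero _⟩
  add U s t hs ht := ⟨(HolSubsheaf.whole E).add U s t hs.1 ht.1,
    fun x hx i hi => by rw [map_add, hs.2 x hx i hi, ht.2 x hx i hi, add_zero]⟩
  smul U f s hf hs := ⟨(HolSubsheaf.whole E).smul U f s hf hs.1,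
    fun x hx i hi => by rw [map_smul, hs.2 x hx i hi, smul_zero]⟩
  restrict U V s h hs := ⟨hs.1.mono h, fun x hx => hs.2 x (h hx)⟩
  glue U s h := ⟨(HolSubsheaf.whole E).glue U s fun x hx => by
      obtain ⟨V, hxV, hVU, hV⟩ := h x hx
      exact ⟨V, hxV, hVU, hV.1⟩, fun x hx => by
      obtain ⟨V, hxV, -, hV⟩ := h x hx
      exact hV.2 x hxV⟩

theorem partialSum_univ : D.partialSum Finset.univ = HolSubsheaf.whole E := by
  have : (D.partialSum Finset.univ).mem = (HolSubsheaf.whole E).mem := by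
    funext U s
    simp [partialSum, HolSubsheaf.whole]
  cases h1 : D.partialSum Finset.univ
  cases h2 : HolSubsheaf.whole E
  rw [h1, h2] at this
  subst this
  rfl

variable {D} in
theorem isBasisOn_partialSum {I : Finset (Fin r)} (x : X) :
    (D.partialSum I).IsBasisOn (D.frameDomain x)
      fun k : Fin I.card => D.frame (I.orderEmbOfFin rfl k) x := by
  have hsum : ∀ {y : X} (g : Fin r → E.Fib y), (∀ i ∉ I, g i = 0) →
      ∑ k : Fin I.card, g (I.orderEmbOfFin rfl k) = ∑ i, g i := fun {y} g hg => by
    rw [← Finset.sum_subset I.subset_univ fun i _ hi => hg i hi]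
    conv_rhs => rw [← I.map_orderEmbOfFin_univ rfl, Finset.sum_map]
    rfl
  refine ⟨fun k => ⟨D.isHolSection_frame _ x, fun y _ i hi => ?_⟩, fun V t hV ht => ?_,
    fun V f hV _ h => ?_⟩
  · refine D.coord_incl_of_ne (fun h => hi ?_) y _
    rw [h]
    exact I.orderEmbOfFin_mem rfl k
  · refine ⟨fun k => D.coeff (I.orderEmbOfFin rfl k) x t,
      fun k => D.isHolFun_coeff hV ht.1 _, fun p hp => ?_⟩
    rw [hsum (fun i => D.coeff i x t p • D.frame i x p), D.sum_coeff_smul_frame (hV hp)]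
    intro i hi
    rw [D.coeff_smul_frame (hV hp), ht.2 p hp i hi, map_zero]
  · intro k p hp
    have h1 := h p hp
    -- The coefficients are extended by `0` to all indices.
    set g : Fin r → ℂ := Function.extend (I.orderEmbOfFin rfl) (fun k => f k p) 0
    have hgk : ∀ k, g (I.orderEmbOfFin rfl k) = f k p := fun k =>
      (I.orderEmbOfFin rfl).injective.extend_apply _ _ k
    have hgi : ∀ i ∉ I, g i = 0 := fun i hi => by
      refine Function.extend_apply' _ _ _ ?_
      rintro ⟨k, rfl⟩
      exact hi (I.orderEmbOfFin_mem rfl k)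
    have h2 : ∑ i, g i • D.frame i x p = 0 := by
      rw [← hsum (fun i => g i • D.frame i x p) fun i hi => by rw [hgi i hi, zero_smul]]
      simpa only [hgk] using h1
    rw [← hgk, D.eq_zero_of_sum_smul_frame_eq_zero (hV hp) h2, Pi.zero_apply]

theorem isCoherent_partialSum (I : Finset (Fin r)) : (D.partialSum I).IsCoherent := fun x => by
  obtain ⟨h1, h2, -⟩ := isBasisOn_partialSum (D := D) (I := I) x
  refine ⟨_, D.mem_frameDomain x, _, _, h1, fun V t hV ht y hy => ⟨V, hy, le_rfl, ?_⟩⟩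
  exact h2 V t hV ht

/-- The determinant of `⨁_{i ∈ I} L i` is `⨂_{i ∈ I} L i`. The subsheaf is locally free everywhere,
so no exceptional analytic subset is needed, and the isomorphism takes the tensor product of the
preferred frames to their wedge product. -/
theorem isDeterminant_partialSum (I : Finset (Fin r)) :
    (D.partialSum I).IsDeterminant I.card (tensorBundle fun k => L (I.orderEmbOfFin rfl k)) := by
  set L' : Fin I.card → HolBundle.{u, w, 0} n X ℂ := fun k => L (I.orderEmbOfFin rfl k)
  refine ⟨∅, isAnalyticCodimGeTwo_empty, fun y =>
    (LinearMap.toSpanSingleton ℂ _ (exteriorPower.ιMulti ℂ I.card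
      fun k => D.frame (I.orderEmbOfFin rfl k) y y)) ∘ₗ (tensorFibEquiv L' y).toLinearMap,
    fun x _ => ⟨D.frameDomain x, D.mem_frameDomain x, by simp, (tensorBundle L').frame x, _,
      ((tensorBundle L').isHolSection_frame x).mono fun y hy => ?_, fun y hy => ?_,
      isBasisOn_partialSum x, fun y hy => ?_⟩⟩
  · exact (mem_tensorBundle_base L').2 fun k => mem_base_of_mem_frameDomain hy _
  · exact HolBundle.frame_ne_zero
      ((mem_tensorBundle_base L').2 fun k => mem_base_of_mem_frameDomain hy _)
  · have hy' : ∀ k, y ∈ (L' k).base x := fun k => mem_base_of_mem_frameDomain hy _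
    have h : ∀ k, D.frame (I.orderEmbOfFin rfl k) x y =
        (L' k).transition x y y • D.frame (I.orderEmbOfFin rfl k) y y := fun k => by
      rw [frame, HolBundle.frame_eq_transition_smul (hy' k) ((L' k).mem_base y), map_smul]
      rfl
    simp only [h, AlternatingMap.map_smul_univ]
    rw [LinearMap.comp_apply, LinearEquiv.coe_coe, tensorFibEquiv_frame L' hy',
      LinearMap.toSpanSingleton_apply]

theorem hasRankDegree_partialSum [IsManifold 𝓘(ℂ, Cn n) ω X] [CompactSpace X] [T2Space X]
    (κ : KaehlerForm n X) {m : Fin r → ℝ} (hm : ∀ j, HasDegree κ (L j) (m j))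
    (I : Finset (Fin r)) : (D.partialSum I).HasRankDegree κ I.card (∑ i ∈ I, m i) := by
  refine ⟨_, D.isDeterminant_partialSum I, ?_⟩
  have h := hasDegree_tensorBundle κ fun k : Fin I.card => hm (I.orderEmbOfFin rfl k)
  convert h using 1
  conv_lhs => rw [← I.map_orderEmbOfFin_univ rfl, Finset.sum_map]
  rfl

/-- If no nonzero component of the Higgs field leads out of `I`, the Higgs field preserves
`⨁_{i ∈ I} L i`. -/
theorem preserves_partialSum [IsManifold 𝓘(ℂ, Cn n) ω X] (Φ : HiggsField E) {I : Finset (Fin r)}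
    (hI : IsForwardClosed (D.ComponentNeZero Φ) I) : Φ.Preserves (D.partialSum I) := by
  refine fun U ξ s hξ hs => ⟨Φ.holomorphic U ξ s hξ hs.1, fun x hx i hi => ?_⟩
  dsimp only
  rw [← D.sum_incl_coord x (s x), map_sum, map_sum]
  refine Finset.sum_eq_zero fun j _ => ?_
  by_cases hj : j ∈ I
  · by_contra h
    refine hi (hI i j hj ⟨x, ξ x, fun h0 => h ?_⟩)
    exact LinearMap.congr_fun h0 (D.coord j x (s x))
  · rw [hs.2 x hx j hj, map_zero, map_zero, map_zero]

end LineDecomposition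

end PartialSum

/-! ### Slope inequalities for the partial sums -/

section Slope

variable {n : ℕ} {X : Type*} [TopologicalSpace X] [ChartedSpace (Cn n) X]
  [IsManifold 𝓘(ℂ, Cn n) ω X] [CompactSpace X] [T2Space X] {κ : KaehlerForm n X} {r : ℕ}
  {E : HolBundle n X (Fin r → ℂ)} {Φ : HiggsField E} {L : Fin r → HolBundle n X ℂ}
  {D : LineDecomposition E L} {m : Fin r → ℝ}

theorem LineDecomposition.hasRankDegree_whole (D : LineDecomposition E L)
    (hm : ∀ j, HasDegree κ (L j) (m j)) :
    (HolSubsheaf.whole E).HasRankDegree κ r (∑ j, m j) := by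
  have h := D.hasRankDegree_partialSum κ hm Finset.univ
  rwa [D.partialSum_univ, Finset.card_univ, Fintype.card_fin] at h

theorem IsSemistable.sum_nonpos (h : IsSemistable κ E Φ) (hm : ∀ j, HasDegree κ (L j) (m j))
    (hE : ∑ j, m j = 0) {I : Finset (Fin r)} (hI : IsForwardClosed (D.ComponentNeZero Φ) I)
    (h0 : I.Nonempty) (h1 : I ≠ Finset.univ) : ∑ i ∈ I, m i ≤ 0 := by
  have hlt : I.card < r := by simpa using (Finset.card_lt_iff_ne_univ I).2 h1
  have hs := h _ (D.isCoherent_partialSum I) (D.preserves_partialSum Φ hI) I.card _ _ h0.card_pos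
    hlt (D.hasRankDegree_partialSum κ hm I) (D.hasRankDegree_whole hm)
  rwa [hE, zero_div, div_le_iff₀ (by exact_mod_cast h0.card_pos), zero_mul] at hs

theorem IsStable.sum_neg (h : IsStable κ E Φ) (hm : ∀ j, HasDegree κ (L j) (m j))
    (hE : ∑ j, m j = 0) {I : Finset (Fin r)} (hI : IsForwardClosed (D.ComponentNeZero Φ) I)
    (h0 : I.Nonempty) (h1 : I ≠ Finset.univ) : ∑ i ∈ I, m i < 0 := by
  have hlt : I.card < r := by simpa using (Finset.card_lt_iff_ne_univ I).2 h1
  have hs := h _ (D.isCoherent_partialSum I) (D.preserves_partialSum Φ hI) I.card _ _ h0.card_pos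
    hlt (D.hasRankDegree_partialSum κ hm I) (D.hasRankDegree_whole hm)
  rwa [hE, zero_div, div_lt_iff₀ (by exact_mod_cast h0.card_pos), zero_mul] at hs

end Slope

end HiggsCone

end

theorem mainTheorem4 {n : ℕ} {X : Type*} [TopologicalSpace X] [ChartedSpace (HiggsCone.Cn n) X]
    [IsManifold 𝓘(ℂ, HiggsCone.Cn n) ω X] [CompactSpace X] [ConnectedSpace X] [T2Space X]
    (κ : HiggsCone.KaehlerForm n X) {r : ℕ}
    (E : HiggsCone.HolBundle n X (Fin r → ℂ)) (Φ : HiggsCone.HiggsField E)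
    (L : Fin r → HiggsCone.HolBundle n X ℂ) (D : HiggsCone.LineDecomposition E L)
    (m : Fin r → ℝ) (hm : ∀ j, HiggsCone.HasDegree κ (L j) (m j)) (hE : ∑ j, m j = 0) :
    (HiggsCone.IsSemistable κ E Φ →
      -m ∈ HiggsCone.closedCone ℝ (D.ComponentNeZero Φ) ∧
      ∀ γ : Fin r → ℚ, (∀ j, (γ j : ℝ) = m j) →
        -γ ∈ HiggsCone.closedCone ℚ (D.ComponentNeZero Φ)) ∧
    (HiggsCone.IsStable κ E Φ →
      -m ∈ HiggsCone.openCone ℝ (D.ComponentNeZero Φ) ∧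
      ∀ γ : Fin r → ℚ, (∀ j, (γ j : ℝ) = m j) →
        -γ ∈ HiggsCone.openCone ℚ (D.ComponentNeZero Φ)) := by
  have cast_sum : ∀ {γ : Fin r → ℚ}, (∀ j, (γ j : ℝ) = m j) → ∀ I : Finset (Fin r),
      ((∑ i ∈ I, γ i : ℚ) : ℝ) = ∑ i ∈ I, m i := fun hγ I => by
    push_cast
    exact Finset.sum_congr rfl fun i _ => hγ i
  have cast_zero : ∀ {γ : Fin r → ℚ}, (∀ j, (γ j : ℝ) = m j) → ∑ i, γ i = 0 := fun hγ => by
    rw [← Rat.cast_inj (α := ℝ), cast_sum hγ, hE, Rat.cast_zero]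
  refine ⟨fun h => ⟨?_, fun γ hγ => ?_⟩, fun h => ⟨?_, fun γ hγ => ?_⟩⟩
  · exact HiggsCone.neg_mem_closedCone hE fun I hI h0 h1 => h.sum_nonpos hm hE hI h0 h1
  · refine HiggsCone.neg_mem_closedCone (cast_zero hγ) fun I hI h0 h1 => ?_
    rw [← Rat.cast_nonpos (K := ℝ), cast_sum hγ]
    exact h.sum_nonpos hm hE hI h0 h1
  · exact HiggsCone.neg_mem_openCone hE fun I hI h0 h1 => h.sum_neg hm hE hI h0 h1
  · refine HiggsCone.neg_mem_openCone (cast_zero hγ) fun I hI h0 h1 => ?_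
    rw [← Rat.cast_lt_zero (K := ℝ), cast_sum hγ]
    exact h.sum_neg hm hE hI h0 h1
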